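/- Let $\mathcal{H}$ be a separable complex Hilbert space of finite or infinite dimension, with unit sphere $\mathbb{S}(\mathcal{H})=\{\psi\in\mathcal{H}:\|\psi\|=1\}$ carrying its Borel $\sigma$-algebra, and let $\rho$ be a density matrix on $\mathcal{H}$, i.e., a positive bounded operator with $\operatorname{tr}\rho=1$. Write $\rho=\sum_n p_n|n\rangle\langle n|$ with an orthonormal basis $(|n\rangle)_n$ of eigenvectors, let $(Z_n)_n$ be independent complex random variables such that $\mathrm{Re}\,Z_n$ and $\mathrm{Im}\,Z_n$ are independent centred real Gaussians with variance $p_n/2$ each, and let $\mathrm{G}(\rho)$ be the distribution of $\sum_n Z_n|n\rangle$ on $\mathcal{H}$. Let $\mathrm{GA}(\rho)$ be the measure on $\mathcal{H}$ with density $\|\psi\|^2$ relative to $\mathrm{G}(\rho)$, and let $\mathrm{GAP}(\rho)$ be the distribution on $\mathbb{S}(\mathcal{H})$ of $\Psi/\|\Psi\|$, where $\Psi$ has distribution $\mathrm{GA}(\rho)$. Let $\eta>0$ and let $f:\mathbb{S}(\mathcal{H})\to\mathbb{R}$ satisfy $|f(\psi)-f(\phi)|\le\eta\,\arccos\mathrm{Re}\langle\psi|\phi\rangle$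 for all $\psi,\phi\in\mathbb{S}(\mathcal{H})$, i.e., $f$ is Lipschitz with constant $\eta$ in the spherical metric. Let $\varepsilon\ge 0$. Then $\mathrm{GAP}(\rho)$ is a probability measure, $f$ is $\mathrm{GAP}(\rho)$-integrable, and with $\mathrm{GAP}(\rho)(f):=\int f\,d\,\mathrm{GAP}(\rho)$ and the operator norm $\|\rho\|$, $$\mathrm{GAP}(\rho)\Bigl\{\psi\in\mathbb{S}(\mathcal{H}):\bigl|f(\psi)-\mathrm{GAP}(\rho)(f)\bigr|>\varepsilon\Bigr\}\le 6\exp\left(-\frac{C\varepsilon^2}{\eta^2\|\rho\|}\right),\qquad C=\frac{1}{288\pi^2}.$$ -/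

import Mathlib

open MeasureTheory ProbabilityTheory
open scoped NNReal ENNReal InnerProductSpace

noncomputable section

/-- A density operator (density matrix) on a complex Hilbert space: a bounded positive operator
with trace one. The trace is the unconditional sum of the diagonal matrix elements with respect to
an orthonormal basis; for positive operators it does not depend on the basis. -/
structure DensityOperator (H : Type*) [NormedAddCommGroup H] [InnerProductSpace ℂ H]
    [CompleteSpace H] where
  /-- the underlying bounded operator -/
  op : H →L[ℂ] H
  isPositive : op.IsPositive
  trace_eq_one : ∃ (w : Set H) (b : HilbertBasis w ℂ H), HasSum (fun i => ⟪b i, op (b i)⟫_ℂ) 1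

/-- An orthonormal basis of eigenvectors of an operator, with its (nonnegative) eigenvalues. -/
structure EigenONB {H : Type*} [NormedAddCommGroup H] [InnerProductSpace ℂ H]
    (T : H →L[ℂ] H) where
  /-- the index set of the basis -/
  index : Set H
  /-- the orthonormal basis -/
  basis : HilbertBasis index ℂ H
  /-- the eigenvalues -/
  eigenvalue : index → ℝ≥0
  apply_basis : ∀ n, T (basis n) = ((eigenvalue n : ℝ) : ℂ) • basis n

/-- A bounded operator whose matrix columns in some orthonormal basis are square summable
is compact. -/
theorem isCompactOperator_of_summable_sq {H : Type*} [NormedAddCommGroup H]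
    [InnerProductSpace ℂ H] [CompleteSpace H] (S : H →L[ℂ] H) {ι : Type*}
    (b : HilbertBasis ι ℂ H) (hS : Summable fun i => ‖S (b i)‖ ^ 2) : IsCompactOperator S := by
  classical
  let A : ι → H →L[ℂ] H := fun i =>
    (ContinuousLinearMap.toSpanSingleton ℂ (S (b i))).comp (innerSL ℂ (b i))
  have hA : ∀ i x, A i x = ⟪b i, x⟫_ℂ • S (b i) := fun i x => by simp [A]
  have hAc : ∀ i, A i ∈ compactOperator (RingHom.id ℂ) H H := fun i => by
    have hc : IsCompactOperator (ContinuousLinearMap.toSpanSingleton ℂ (S (b i))) :=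
      isCompactOperator_of_locallyCompactSpace_rng
        (ContinuousLinearMap.toSpanSingleton ℂ (S (b i)))
    exact hc.comp_clm (innerSL ℂ (b i))
  clear_value A
  have hbound : ∀ G : Finset ι, ‖∑ i ∈ G, A i‖ ≤ √(∑ i ∈ G, ‖S (b i)‖ ^ 2) := by
    intro G
    refine ContinuousLinearMap.opNorm_le_bound _ (Real.sqrt_nonneg _) fun x => ?_
    rw [sum_apply]
    calc ‖∑ i ∈ G, A i x‖ ≤ ∑ i ∈ G, ‖⟪b i, x⟫_ℂ‖ * ‖S (b i)‖ := by
          refine (norm_sum_le _ _).trans (Finset.sum_le_sum fun i _ => ?_)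
          rw [hA, norm_smul]
      _ ≤ √(∑ i ∈ G, ‖⟪b i, x⟫_ℂ‖ ^ 2) * √(∑ i ∈ G, ‖S (b i)‖ ^ 2) :=
          Real.sum_mul_le_sqrt_mul_sqrt _ _ _
      _ ≤ ‖x‖ * √(∑ i ∈ G, ‖S (b i)‖ ^ 2) := by
          gcongr
          exact Real.sqrt_le_iff.2 ⟨norm_nonneg _, b.orthonormal.sum_inner_products_le x⟩
      _ = _ := mul_comm _ _
  have hsum : Summable A := by
    rw [summable_iff_vanishing_norm]
    intro ε hε
    obtain ⟨F, hF⟩ := summable_iff_vanishing_norm.1 hS (ε ^ 2) (by positivity)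
    refine ⟨F, fun G hG => (hbound G).trans_lt ?_⟩
    rw [Real.sqrt_lt' hε]
    exact (le_abs_self _).trans_lt (hF G hG)
  have heq : ∑' i, A i = S := by
    ext x
    let ev : (H →L[ℂ] H) →L[ℂ] H := ContinuousLinearMap.apply ℂ H x
    have h1 : HasSum (fun i => A i x) ((∑' i, A i) x) := ev.hasSum hsum.hasSum
    have h2 : HasSum (fun i => A i x) (S x) := by
      have := S.hasSum (b.hasSum_repr x)
      simpa [hA, b.repr_apply_apply] using this
    exact h1.unique h2
  refine isCompactOperator_of_tendsto (heq ▸ hsum.hasSum : HasSum A S) ?_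
  refine Filter.Eventually.of_forall fun G => ?_
  exact Submodule.sum_mem _ fun i _ => hAc i

theorem DensityOperator.isCompactOperator {H : Type*} [NormedAddCommGroup H]
    [InnerProductSpace ℂ H] [CompleteSpace H] (ρ : DensityOperator H) :
    IsCompactOperator ρ.op := by
  obtain ⟨w, b, hb⟩ := ρ.trace_eq_one
  have h0 : 0 ≤ ρ.op := (ContinuousLinearMap.nonneg_iff_isPositive _).2 ρ.isPositive
  set S := CFC.sqrt ρ.op with hSdef
  have hSS : S * S = ρ.op := CFC.sqrt_mul_sqrt_self ρ.op h0
  have hSsymm : S.IsSymmetric :=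
    ((ContinuousLinearMap.nonneg_iff_isPositive _).1 (CFC.sqrt_nonneg ρ.op)).isSymmetric
  have hS : IsCompactOperator S := by
    refine isCompactOperator_of_summable_sq S b ?_
    refine (Complex.hasSum_re hb).summable.congr fun i => ?_
    rw [← hSS]
    change (⟪b i, S (S (b i))⟫_ℂ).re = ‖S (b i)‖ ^ 2
    have := hSsymm (b i) (S (b i))
    simp only [ContinuousLinearMap.coe_coe] at this
    rw [← this, inner_self_eq_norm_sq_to_K]
    norm_cast
  rw [← hSS]
  exact hS.comp_clm S

open scoped ComplexOrder in
/-- Every density operator has an orthonormal basis of eigenvectors. -/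
theorem DensityOperator.nonempty_eigenONB {H : Type*} [NormedAddCommGroup H]
    [InnerProductSpace ℂ H] [CompleteSpace H] (ρ : DensityOperator H) :
    Nonempty (EigenONB ρ.op) := by
  classical
  let E : ℂ → Submodule ℂ H := fun μ => Module.End.eigenspace (ρ.op : Module.End ℂ H) μ
  have hcompl : ∀ μ, CompleteSpace (E μ) := fun μ => by
    have hc : IsClosed (E μ : Set H) := by
      have : (E μ : Set H) = {x | ρ.op x = μ • x} := by
        ext x; simp [E]
      rw [this]
      exact isClosed_eq ρ.op.continuous (continuous_const_smul μ)
    exact hc.completeSpace_coe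
  choose W B hB using fun μ => exists_hilbertBasis ℂ (E μ)
  have horth : OrthogonalFamily ℂ (fun μ => E μ) fun μ => (E μ).subtypeₗᵢ :=
    ρ.isPositive.isSymmetric.orthogonalFamily_eigenspaces
  let v : (Σ μ, W μ) → H := fun a => (B a.1 a.2 : H)
  have hv : Orthonormal ℂ v :=
    horth.orthonormal_sigma_orthonormal fun μ => (B μ).orthonormal
  have hbot : (Submodule.span ℂ (Set.range ((↑) : Set.range v → H)))ᗮ = ⊥ := by
    rw [Subtype.range_coe, eq_bot_iff,
      ← ContinuousLinearMap.orthogonalComplement_iSup_eigenspaces_eq_bot ρ.isCompactOperator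
        ρ.isPositive.isSymmetric, ← Submodule.iInf_orthogonal]
    intro x hx
    rw [Submodule.mem_iInf]
    intro μ
    rw [Submodule.mem_orthogonal]
    intro u hu
    have hall : ∀ i, ⟪x, (B μ i : H)⟫_ℂ = 0 := fun i =>
      Submodule.inner_left_of_mem_orthogonal
        (Submodule.subset_span (Set.mem_range_self (f := v) ⟨μ, i⟩)) hx
    have h1 := ((innerSL ℂ x).comp (E μ).subtypeL).hasSum ((B μ).hasSum_repr ⟨u, hu⟩)
    have h2 : ⟪x, u⟫_ℂ = 0 := by
      refine h1.unique ?_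
      convert hasSum_zero using 2 with i
      simp [hall]
    exact inner_eq_zero_symm.1 h2
  have hmk := HilbertBasis.coe_mkOfOrthogonalEqBot hv.toSubtypeRange hbot
  have heig : ∀ n : Set.range v, ∃ p : ℝ≥0, ρ.op n = ((p : ℝ) : ℂ) • (n : H) := by
    rintro ⟨_, ⟨⟨μ, i⟩, rfl⟩⟩
    have hx : ρ.op (v ⟨μ, i⟩) = μ • v ⟨μ, i⟩ := Module.End.mem_eigenspace_iff.1 (B μ i).2
    have hn : ‖v ⟨μ, i⟩‖ = 1 := hv.1 _
    have hpos : 0 ≤ ⟪v ⟨μ, i⟩, ρ.op (v ⟨μ, i⟩)⟫_ℂ := ρ.isPositive.inner_nonneg_right _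
    rw [hx, inner_smul_right, inner_self_eq_norm_sq_to_K, hn] at hpos
    simp only [RCLike.ofReal_one, one_pow, mul_one] at hpos
    obtain ⟨hre, him⟩ := Complex.nonneg_iff.1 hpos
    refine ⟨⟨μ.re, hre⟩, ?_⟩
    have hμ : ((μ.re : ℝ) : ℂ) = μ := Complex.ext (by simp) (by simpa using him)
    change ρ.op (v ⟨μ, i⟩) = ((μ.re : ℝ) : ℂ) • v ⟨μ, i⟩
    rw [hμ, hx]
  choose p hp using heig
  exact ⟨⟨Set.range v, HilbertBasis.mkOfOrthogonalEqBot hv.toSubtypeRange hbot, p,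
    fun n => by rw [hmk]; exact hp n⟩⟩

/-- An eigenbasis `(|n⟩)` of the density operator `ρ`, with eigenvalues `p n`. -/
def DensityOperator.eigenONB {H : Type*} [NormedAddCommGroup H] [InnerProductSpace ℂ H]
    [CompleteSpace H] (ρ : DensityOperator H) : EigenONB ρ.op :=
  Classical.choice ρ.nonempty_eigenONB

/-- The centred complex Gaussian distribution with variance `p`: real and imaginary part are
independent centred real Gaussians, each with variance `p / 2`. -/
def complexGaussian (p : ℝ≥0) : Measure ℂ :=
  ((gaussianReal 0 (p / 2)).prod (gaussianReal 0 (p / 2))).map fun z => (⟨z.1, z.2⟩ : ℂ)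

/-- The Gaussian measure `G(ρ)`: the law of `∑ₙ Zₙ |n⟩`, where the `Zₙ` are independent centred
complex Gaussians with variances the eigenvalues `p n` of `ρ`, realised as the coordinates of a
product space. -/
def gaussianMeasure {H : Type*} [NormedAddCommGroup H] [InnerProductSpace ℂ H] [CompleteSpace H]
    [MeasurableSpace H] (ρ : DensityOperator H) : Measure H :=
  (Measure.infinitePi fun n => complexGaussian (ρ.eigenONB.eigenvalue n)).map
    fun Z => ∑' n, Z n • ρ.eigenONB.basis n

/-- The adjusted Gaussian measure `GA(ρ)`, with density `‖ψ‖²` relative to `G(ρ)`. -/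
def gaMeasure {H : Type*} [NormedAddCommGroup H] [InnerProductSpace ℂ H] [CompleteSpace H]
    [MeasurableSpace H] (ρ : DensityOperator H) : Measure H :=
  (gaussianMeasure ρ).withDensity fun ψ => ENNReal.ofReal (‖ψ‖ ^ 2)

/-- The measure `GAP(ρ)` on the unit sphere: the law of `Ψ / ‖Ψ‖`, where `Ψ` has law `GA(ρ)`. -/
def gapMeasure {H : Type*} [NormedAddCommGroup H] [InnerProductSpace ℂ H] [CompleteSpace H]
    [MeasurableSpace H] (ρ : DensityOperator H) : Measure (Metric.sphere (0 : H) 1) :=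
  ((gaMeasure ρ).map fun ψ => ((‖ψ‖⁻¹ : ℝ) : ℂ) • ψ).comap ((↑) : Metric.sphere (0 : H) 1 → H)

/-- The spherical (geodesic) distance on the unit sphere. -/
def sphericalDist {H : Type*} [NormedAddCommGroup H] [InnerProductSpace ℂ H]
    (ψ φ : Metric.sphere (0 : H) 1) : ℝ :=
  Real.arccos (⟪(ψ : H), (φ : H)⟫_ℂ).re

end

/-! The measure `GAP ρ` is the image of `GA ρ` under the radial projection of `H` to the sphere, so
an `η`-Lipschitz function on the sphere becomes a function `q` on `H` which oscillates by at most
`π η` and has Lipschitz constant `π η / ‖x‖` at `x`. Its Gaussian concentration comes from the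
Maurey–Pisier argument: for independent `X, Y` with the same centred Gaussian law, rotate `X` into
`Y`; rotation invariance reduces the exponential moments of `F Y - F X` to those of a
one-dimensional Gaussian, with the variance proxy `π ^ 2 * ‖ρ‖ / 8` independent of the dimension.
This bound passes from finitely many coordinates to the limit `G ρ`. The density `‖x‖ ^ 2` of `GA ρ`
costs at most `exp (2 * (‖x‖ - 1))`, which is harmless because `‖x‖` concentrates near one, and
Chernoff's bound for the Lipschitz function `‖x‖ * (q x - m - ε)`, where `m` is the mean of `q`
under `GA ρ`, yields the exponent `ε ^ 2 / (18 * π ^ 4 * η ^ 2 * ‖ρ‖)`. Since `π ^ 2 ≤ 16`, this is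
at least the asserted one. -/

section ExponentialMoments

variable {Ω : Type*} [MeasurableSpace Ω] {μ : Measure Ω}

theorem ofReal_exp_integral_le_lintegral [IsProbabilityMeasure μ] {g : Ω → ℝ}
    (hg : Integrable g μ) :
    ENNReal.ofReal (Real.exp (∫ x, g x ∂μ)) ≤ ∫⁻ x, ENNReal.ofReal (Real.exp (g x)) ∂μ := by
  have hpos : 0 ≤ᵐ[μ] fun x => Real.exp (g x) := ae_of_all _ fun _ => (Real.exp_pos _).le
  by_cases htop : ∫⁻ x, ENNReal.ofReal (Real.exp (g x)) ∂μ = ⊤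
  · simp [htop]
  have hint : Integrable (fun x => Real.exp (g x)) μ :=
    (lintegral_ofReal_ne_top_iff_integrable
      (Real.continuous_exp.comp_aestronglyMeasurable hg.aestronglyMeasurable) hpos).1 htop
  rw [← ofReal_integral_eq_lintegral_ofReal hint hpos]
  exact ENNReal.ofReal_le_ofReal (convexOn_exp.map_integral_le Real.continuous_exp.continuousOn
    isClosed_univ (ae_of_all _ fun _ => Set.mem_univ _) hg hint)

theorem hasSubgaussianMGF_of_lintegral_exp_le {X : Ω → ℝ} {c : ℝ≥0} (hX : AEMeasurable X μ)
    (h : ∀ t : ℝ, ∫⁻ ω, ENNReal.ofReal (Real.exp (t * X ω)) ∂μ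
      ≤ ENNReal.ofReal (Real.exp (c * t ^ 2 / 2))) :
    HasSubgaussianMGF X c μ := by
  have hpos (t : ℝ) : 0 ≤ᵐ[μ] fun ω => Real.exp (t * X ω) :=
    ae_of_all _ fun _ => (Real.exp_pos _).le
  have hint (t : ℝ) : Integrable (fun ω => Real.exp (t * X ω)) μ :=
    (lintegral_ofReal_ne_top_iff_integrable
      (hX.const_mul t).exp.aestronglyMeasurable (hpos t)).1
      ((h t).trans_lt ENNReal.ofReal_lt_top).ne
  refine ⟨hint, fun t => ?_⟩
  rw [← ENNReal.ofReal_le_ofReal_iff (Real.exp_pos _).le, mgf,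
    ofReal_integral_eq_lintegral_ofReal (hint t) (hpos t)]
  exact h t

theorem sq_le_exp_add_exp_neg_sub_two (x : ℝ) : x ^ 2 ≤ Real.exp x + Real.exp (-x) - 2 := by
  have hsinh : (x / 2) ^ 2 ≤ Real.sinh (x / 2) ^ 2 := by
    rw [sq_le_sq, Real.abs_sinh]
    exact Real.self_le_sinh_iff.2 (abs_nonneg _)
  have hcosh : Real.cosh x = 2 * Real.sinh (x / 2) ^ 2 + 1 := by
    have h := Real.cosh_two_mul (x / 2)
    rw [mul_div_cancel₀ x two_ne_zero, Real.cosh_sq] at h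
    linarith
  rw [Real.cosh_eq] at hcosh
  linarith

theorem integral_sq_le_of_hasSubgaussianMGF [IsProbabilityMeasure μ] {X : Ω → ℝ} {c : ℝ≥0}
    (hX : HasSubgaussianMGF X c μ) : ∫ ω, X ω ^ 2 ∂μ ≤ 2 * c := by
  rcases eq_or_ne c 0 with rfl | hc
  · have h0 : (fun ω => X ω ^ 2) =ᵐ[μ] 0 := by
      filter_upwards [hX.ae_eq_zero_of_hasSubgaussianMGF_zero] with ω hω
      simp [hω]
    simp [integral_congr_ae h0]
  have hcpos : (0 : ℝ) < c := by positivity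
  obtain ⟨t, ht⟩ : ∃ t : ℝ, t ^ 2 = 2 / c := ⟨√(2 / c), Real.sq_sqrt (by positivity)⟩
  have hmgf (s : ℝ) (hs : s ^ 2 = t ^ 2) : ∫ ω, Real.exp (s * X ω) ∂μ ≤ Real.exp 1 := by
    have h := hX.mgf_le s
    rwa [hs, ht, mul_div_cancel₀ _ hcpos.ne', div_self two_ne_zero] at h
  have hint (s : ℝ) := hX.integrable_exp_mul s
  have hsq : Integrable (fun ω => X ω ^ 2) μ := (hX.memLp 2).integrable_sq
  have hle : ∫ ω, (t * X ω) ^ 2 ∂μ ≤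
      ∫ ω, (Real.exp (t * X ω) + Real.exp (-t * X ω) - 2) ∂μ := by
    refine integral_mono (by simpa only [mul_pow] using hsq.const_mul (t ^ 2))
      (((hint t).add (hint (-t))).sub (integrable_const 2)) fun ω => ?_
    simpa only [neg_mul] using sq_le_exp_add_exp_neg_sub_two (t * X ω)
  rw [integral_sub ((hint t).fun_add (hint (-t))) (integrable_const 2),
    integral_add (hint t) (hint (-t))] at hle
  simp only [mul_pow, ht, integral_const_mul, integral_const, probReal_univ, one_smul] at hle
  have h4 : 2 / c * ∫ ω, X ω ^ 2 ∂μ ≤ 4 := by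
    linarith [hmgf t rfl, hmgf (-t) (neg_sq t), Real.exp_one_lt_d9]
  rw [div_mul_eq_mul_div, div_le_iff₀ hcpos] at h4
  linarith

end ExponentialMoments

/-- Sub-Gaussian concentration of Lipschitz functions with variance proxy `v`: for independent
`X, Y` of law `μ` and every `K`-Lipschitz `F`, `𝔼 exp (F Y - F X) ≤ exp (K ^ 2 * v / 2)`.
The two-sample form presupposes no integrability and passes to almost sure limits. -/
def SubgaussianLipschitz {E : Type*} [PseudoMetricSpace E] [MeasurableSpace E] (μ : Measure E)
    (v : ℝ≥0) : Prop :=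
  ∀ ⦃K : ℝ≥0⦄ ⦃F : E → ℝ⦄, LipschitzWith K F →
    ∫⁻ z, ENNReal.ofReal (Real.exp (F z.2 - F z.1)) ∂(μ.prod μ)
      ≤ ENNReal.ofReal (Real.exp (K ^ 2 * v / 2))

namespace SubgaussianLipschitz

variable {E : Type*} [PseudoMetricSpace E] [MeasurableSpace E] {μ : Measure E} {v K : ℝ≥0}
  {F : E → ℝ}

theorem lintegral_exp_mul_sub_le (h : SubgaussianLipschitz μ v) (hF : LipschitzWith K F) (t : ℝ) :
    ∫⁻ z, ENNReal.ofReal (Real.exp (t * (F z.2 - F z.1))) ∂(μ.prod μ)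
      ≤ ENNReal.ofReal (Real.exp ((K ^ 2 * v : ℝ≥0) * t ^ 2 / 2)) := by
  convert h ((lipschitzWith_smul t).comp hF) using 4 with z
  · simp [mul_sub]
  · simp only [NNReal.coe_mul, NNReal.coe_pow, coe_nnnorm, Real.norm_eq_abs, mul_pow, sq_abs]
    ring

variable [OpensMeasurableSpace E] [IsProbabilityMeasure μ]

theorem integrable (h : SubgaussianLipschitz μ v) (hF : LipschitzWith K F) :
    Integrable F μ := by
  have hFm : Measurable F := hF.continuous.measurable
  have hpair : Integrable (fun z : E × E => F z.2 - F z.1) (μ.prod μ) :=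
    (hasSubgaussianMGF_of_lintegral_exp_le (by fun_prop)
      (h.lintegral_exp_mul_sub_le hF)).integrable
  obtain ⟨x, hx⟩ := hpair.prod_right_ae.exists
  exact (hx.add (integrable_const (F x))).congr (ae_of_all _ fun y => by simp)

theorem hasSubgaussianMGF_sub_integral (h : SubgaussianLipschitz μ v) (hF : LipschitzWith K F) :
    HasSubgaussianMGF (fun x => F x - ∫ y, F y ∂μ) (K ^ 2 * v) μ := by
  have hFm : Measurable F := hF.continuous.measurable
  have hFi : Integrable F μ := h.integrable hF
  refine hasSubgaussianMGF_of_lintegral_exp_le (by fun_prop) fun t => ?_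
  calc ∫⁻ y, ENNReal.ofReal (Real.exp (t * (F y - ∫ x, F x ∂μ))) ∂μ
      = ∫⁻ y, ENNReal.ofReal (Real.exp (∫ x, t * (F y - F x) ∂μ)) ∂μ := by
        simp [integral_const_mul, integral_sub (integrable_const _) hFi]
    _ ≤ ∫⁻ y, ∫⁻ x, ENNReal.ofReal (Real.exp (t * (F y - F x))) ∂μ ∂μ :=
        lintegral_mono fun y => ofReal_exp_integral_le_lintegral
          (((integrable_const _).sub hFi).const_mul t)
    _ = ∫⁻ z, ENNReal.ofReal (Real.exp (t * (F z.2 - F z.1))) ∂(μ.prod μ) :=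
        (lintegral_prod_symm (fun z : E × E => ENNReal.ofReal (Real.exp (t * (F z.2 - F z.1))))
          (by fun_prop)).symm
    _ ≤ _ := h.lintegral_exp_mul_sub_le hF t

end SubgaussianLipschitz

section Transfer

variable {E Ω : Type*} [MeasurableSpace E] [MeasurableSpace Ω] {P : Measure Ω} [SFinite P]

theorem lintegral_exp_sub_map_prod_map {X : Ω → E} (hX : Measurable X) {F : E → ℝ}
    (hF : Measurable F) :
    ∫⁻ z, ENNReal.ofReal (Real.exp (F z.2 - F z.1)) ∂((P.map X).prod (P.map X))
      = ∫⁻ w, ENNReal.ofReal (Real.exp (F (X w.2) - F (X w.1))) ∂(P.prod P) := by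
  rw [Measure.map_prod_map _ _ hX hX, lintegral_map (by fun_prop) (by fun_prop)]
  rfl

variable [PseudoMetricSpace E] [OpensMeasurableSpace E] {v : ℝ≥0}

theorem SubgaussianLipschitz.map {E' : Type*} [PseudoMetricSpace E'] [MeasurableSpace E']
    [BorelSpace E'] {μ : Measure E} [SFinite μ] (h : SubgaussianLipschitz μ v) {L : ℝ≥0}
    {g : E → E'} (hg : LipschitzWith L g) : SubgaussianLipschitz (μ.map g) (L ^ 2 * v) := by
  intro K F hF
  rw [lintegral_exp_sub_map_prod_map hg.continuous.measurable hF.continuous.measurable]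
  refine (h (hF.comp hg)).trans_eq ?_
  push_cast
  ring_nf

theorem SubgaussianLipschitz.of_ae_tendsto {X : ℕ → Ω → E} {Y : Ω → E}
    (hX : ∀ k, Measurable (X k)) (hY : Measurable Y)
    (hlim : ∀ᵐ ω ∂P, Filter.Tendsto (fun k => X k ω) Filter.atTop (nhds (Y ω)))
    (h : ∀ k, SubgaussianLipschitz (P.map (X k)) v) : SubgaussianLipschitz (P.map Y) v := by
  intro K F hF
  have hFm : Measurable F := hF.continuous.measurable
  let Φ (k : ℕ) (w : Ω × Ω) : ℝ≥0∞ := ENNReal.ofReal (Real.exp (F (X k w.2) - F (X k w.1)))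
  have hΦ : ∀ᵐ w ∂(P.prod P), Filter.Tendsto (fun k => Φ k w) Filter.atTop
      (nhds (ENNReal.ofReal (Real.exp (F (Y w.2) - F (Y w.1))))) := by
    filter_upwards [Measure.quasiMeasurePreserving_fst.ae hlim,
      Measure.quasiMeasurePreserving_snd.ae hlim] with w hw₁ hw₂
    exact ((ENNReal.continuous_ofReal.comp Real.continuous_exp).tendsto _).comp
      (((hF.continuous.tendsto _).comp hw₂).sub ((hF.continuous.tendsto _).comp hw₁))
  rw [lintegral_exp_sub_map_prod_map hY hFm]
  calc ∫⁻ w, ENNReal.ofReal (Real.exp (F (Y w.2) - F (Y w.1))) ∂(P.prod P)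
      = ∫⁻ w, Filter.liminf (fun k => Φ k w) Filter.atTop ∂(P.prod P) :=
        lintegral_congr_ae (hΦ.mono fun _ hw => hw.liminf_eq.symm)
    _ ≤ Filter.liminf (fun k => ∫⁻ w, Φ k w ∂(P.prod P)) Filter.atTop :=
        lintegral_liminf_le fun k => by fun_prop
    _ ≤ ENNReal.ofReal (Real.exp (K ^ 2 * v / 2)) := by
        refine Filter.liminf_le_of_le (by isBoundedDefault) fun a ha => ?_
        obtain ⟨k, hk⟩ := ha.exists
        rw [← lintegral_exp_sub_map_prod_map (hX k) hFm] at hk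
        exact hk.trans (h k hF)

end Transfer

section MaureyPisier

open scoped Convolution ContDiff in
theorem exists_contDiff_lipschitzWith_abs_sub_le {E : Type*} [NormedAddCommGroup E]
    [NormedSpace ℝ E] [FiniteDimensional ℝ E] {K : ℝ≥0} {g : E → ℝ} (hg : LipschitzWith K g)
    {δ : ℝ} (hδ : 0 < δ) :
    ∃ h : E → ℝ, ContDiff ℝ 1 h ∧ LipschitzWith K h ∧ ∀ x, |h x - g x| ≤ δ := by
  borelize E
  obtain ⟨r, hr, hKr⟩ : ∃ r : ℝ, 0 < r ∧ K * r ≤ δ :=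
    ⟨δ / (K + 1), by positivity, by
      rw [mul_div_assoc', div_le_iff₀ (by positivity)]; nlinarith [K.coe_nonneg]⟩
  let φ : ContDiffBump (0 : E) := ⟨r / 2, r, half_pos hr, half_lt_self hr⟩
  let μ : Measure E := Measure.addHaar
  have hli : LocallyIntegrable g μ := hg.continuous.locallyIntegrable
  have hex : ∀ x, ConvolutionExistsAt (φ.normed μ) g x (ContinuousLinearMap.lsmul ℝ ℝ) μ :=
    fun x => (φ.hasCompactSupport_normed.convolutionExists_left _ φ.continuous_normed hli) x
  refine ⟨φ.normed μ ⋆[ContinuousLinearMap.lsmul ℝ ℝ, μ] g,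
    φ.hasCompactSupport_normed.contDiff_convolution_left _ φ.contDiff_normed hli,
    LipschitzWith.of_dist_le_mul fun x y => ?_, fun x => ?_⟩
  · rw [Real.dist_eq, convolution_def, convolution_def, ← integral_sub (hex x) (hex y),
      ← Real.norm_eq_abs]
    calc ‖∫ t, (ContinuousLinearMap.lsmul ℝ ℝ (φ.normed μ t) (g (x - t))
            - ContinuousLinearMap.lsmul ℝ ℝ (φ.normed μ t) (g (y - t))) ∂μ‖
        ≤ ∫ t, φ.normed μ t * (K * dist x y) ∂μ := by
          refine norm_integral_le_of_norm_le (φ.integrable_normed.mul_const _)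
            (ae_of_all _ fun t => ?_)
          have h := hg.dist_le_mul (x - t) (y - t)
          rw [dist_sub_right, Real.dist_eq] at h
          simp only [ContinuousLinearMap.lsmul_apply, smul_eq_mul, ← mul_sub, norm_mul,
            Real.norm_eq_abs, abs_of_nonneg (φ.nonneg_normed t)]
          exact mul_le_mul_of_nonneg_left h (φ.nonneg_normed t)
      _ = K * dist x y := by rw [integral_mul_const, φ.integral_normed, one_mul]
  · rw [← Real.dist_eq]
    refine φ.dist_normed_convolution_le hg.continuous.aestronglyMeasurable fun y hy => ?_
    exact (hg.dist_le_mul y x).trans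
      ((mul_le_mul_of_nonneg_left (Metric.mem_ball.1 hy).le K.coe_nonneg).trans hKr)

/-- The derivative at angle `θ` of `g` along the rotation of `z.1` into `z.2`. For a
rotation invariant law its distribution does not depend on `θ`. -/
noncomputable def rotationDeriv {E : Type*} [NormedAddCommGroup E] [NormedSpace ℝ E] (g : E → ℝ)
    (θ : ℝ) (z : E × E) : ℝ :=
  fderiv ℝ g (ContinuousLinearMap.rotation θ z).1 (ContinuousLinearMap.rotation θ z).2

/-- The uniform distribution on angles between `0` and `π / 2`: the increment `g z.2 - g z.1` is the
mean of `π / 2 * rotationDeriv g θ z` over it, which lets Jensen's inequality apply. -/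
noncomputable def uniformQuarterTurn : Measure ℝ :=
  volume[|Set.Ioc 0 (Real.pi / 2)]

instance isProbabilityMeasure_uniformQuarterTurn : IsProbabilityMeasure uniformQuarterTurn :=
  cond_isProbabilityMeasure_of_finite (by simp [Real.pi_pos]) (by simp)

variable {E : Type*} [NormedAddCommGroup E] [NormedSpace ℝ E] {g : E → ℝ}

theorem continuous_rotationDeriv (hg : ContDiff ℝ 1 g) :
    Continuous (Function.uncurry (rotationDeriv g)) := by
  have : Continuous (fderiv ℝ g) := hg.continuous_fderiv one_ne_zero
  simp only [Function.uncurry_def, rotationDeriv, ContinuousLinearMap.rotation_apply]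
  fun_prop

theorem hasDerivAt_comp_rotation_fst (hg : Differentiable ℝ g) (z : E × E) (θ : ℝ) :
    HasDerivAt (fun θ => g (ContinuousLinearMap.rotation θ z).1) (rotationDeriv g θ z) θ := by
  have hrot : HasDerivAt (fun θ : ℝ => (ContinuousLinearMap.rotation θ z).1)
      (ContinuousLinearMap.rotation θ z).2 θ := by
    simp only [ContinuousLinearMap.rotation_apply]
    exact ((Real.hasDerivAt_cos θ).smul_const z.1).fun_add
      ((Real.hasDerivAt_sin θ).smul_const z.2)
  exact (hg _).hasFDerivAt.comp_hasDerivAt θ hrot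

theorem integrable_rotationDeriv (hg : ContDiff ℝ 1 g) (z : E × E) :
    Integrable (fun θ => rotationDeriv g θ z) uniformQuarterTurn := by
  have hIoc : IntegrableOn (fun θ => rotationDeriv g θ z) (Set.Ioc 0 (Real.pi / 2)) :=
    ((continuous_rotationDeriv hg).uncurry_right z).integrableOn_Icc.mono_set
      Set.Ioc_subset_Icc_self
  exact hIoc.smul_measure (by simp [Real.pi_pos])

theorem integral_rotationDeriv (hg : ContDiff ℝ 1 g) (z : E × E) :
    ∫ θ, Real.pi / 2 * rotationDeriv g θ z ∂uniformQuarterTurn = g z.2 - g z.1 := by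
  have hftc := intervalIntegral.integral_eq_sub_of_hasDerivAt
    (fun θ _ => hasDerivAt_comp_rotation_fst (hg.differentiable one_ne_zero) z θ)
    (((continuous_rotationDeriv hg).uncurry_right z).intervalIntegrable 0 (Real.pi / 2))
  rw [intervalIntegral.integral_of_le (by positivity)] at hftc
  rw [integral_const_mul, uniformQuarterTurn, ProbabilityTheory.cond, integral_smul_measure, hftc]
  simp only [Real.volume_Ioc, sub_zero, ENNReal.toReal_inv,
    ENNReal.toReal_ofReal (half_pos Real.pi_pos).le, smul_eq_mul]
  rw [mul_inv_cancel_left₀ (by positivity)]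
  simp [ContinuousLinearMap.rotation_apply]

variable [CompleteSpace E] [SecondCountableTopology E] [MeasurableSpace E] [BorelSpace E]
  {μ : Measure E} [IsGaussian μ] {v K : ℝ≥0}

theorem lintegral_exp_dual_le (hμ : μ[id] = 0)
    (hv : ∀ L : StrongDual ℝ E, Var[L; μ] ≤ v * ‖L‖ ^ 2) (L : StrongDual ℝ E) :
    ∫⁻ x, ENNReal.ofReal (Real.exp (L x)) ∂μ ≤ ENNReal.ofReal (Real.exp (v * ‖L‖ ^ 2 / 2)) := by
  have hmean : μ[L] = 0 := by
    simp only [id_eq] at hμ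
    simp [IsGaussian.integral_dual, hμ]
  have hlaw : μ.map L = gaussianReal 0 Var[L; μ].toNNReal := by
    rw [IsGaussian.map_eq_gaussianReal, hmean]
  have hint : Integrable (fun x => Real.exp (L x)) μ := by
    have h := integrable_exp_mul_gaussianReal (μ := 0) (v := Var[L; μ].toNNReal) 1
    rw [← hlaw] at h
    simpa [Function.comp_def] using (integrable_map_measure (by fun_prop) (by fun_prop)).1 h
  have hmgf := mgf_gaussianReal hlaw 1
  simp only [mgf, one_mul, zero_add, one_pow, mul_one,
    Real.coe_toNNReal _ (variance_nonneg _ _)] at hmgf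
  rw [← ofReal_integral_eq_lintegral_ofReal hint (ae_of_all _ fun _ => (Real.exp_pos _).le), hmgf]
  gcongr
  exact hv L

theorem lintegral_exp_mul_rotationDeriv_le (hμ : μ[id] = 0)
    (hv : ∀ L : StrongDual ℝ E, Var[L; μ] ≤ v * ‖L‖ ^ 2) (hg : ContDiff ℝ 1 g)
    (hgK : LipschitzWith K g) (c θ : ℝ) :
    ∫⁻ z, ENNReal.ofReal (Real.exp (c * rotationDeriv g θ z)) ∂(μ.prod μ)
      ≤ ENNReal.ofReal (Real.exp (v * (c * K) ^ 2 / 2)) := by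
  have : Continuous (fderiv ℝ g) := hg.continuous_fderiv one_ne_zero
  have hmeas : Measurable fun z : E × E => ENNReal.ofReal (Real.exp (c * fderiv ℝ g z.1 z.2)) :=
    (ENNReal.continuous_ofReal.comp (Real.continuous_exp.comp (by fun_prop))).measurable
  calc ∫⁻ z, ENNReal.ofReal (Real.exp (c * rotationDeriv g θ z)) ∂(μ.prod μ)
      = ∫⁻ z, ENNReal.ofReal (Real.exp (c * fderiv ℝ g z.1 z.2))
          ∂((μ.prod μ).map (ContinuousLinearMap.rotation θ)) :=
        (lintegral_map hmeas (ContinuousLinearMap.rotation θ).continuous.measurable).symm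
    _ = ∫⁻ x, ∫⁻ y, ENNReal.ofReal (Real.exp ((c • fderiv ℝ g x) y)) ∂μ ∂μ := by
        rw [IsGaussian.map_rotation_eq_self hμ, lintegral_prod _ hmeas.aemeasurable]
        rfl
    _ ≤ ∫⁻ _, ENNReal.ofReal (Real.exp (v * (c * K) ^ 2 / 2)) ∂μ := by
        refine lintegral_mono fun x => (lintegral_exp_dual_le hμ hv (c • fderiv ℝ g x)).trans ?_
        rw [norm_smul, mul_pow, mul_pow, Real.norm_eq_abs, sq_abs]
        gcongr
        exact norm_fderiv_le_of_lipschitz ℝ hgK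
    _ = _ := by simp

theorem lintegral_exp_sub_le_of_contDiff (hμ : μ[id] = 0)
    (hv : ∀ L : StrongDual ℝ E, Var[L; μ] ≤ v * ‖L‖ ^ 2) (hg : ContDiff ℝ 1 g)
    (hgK : LipschitzWith K g) :
    ∫⁻ z, ENNReal.ofReal (Real.exp (g z.2 - g z.1)) ∂(μ.prod μ)
      ≤ ENNReal.ofReal (Real.exp (v * (Real.pi / 2 * K) ^ 2 / 2)) := by
  have hmeas : Measurable fun y : (E × E) × ℝ =>
      ENNReal.ofReal (Real.exp (Real.pi / 2 * rotationDeriv g y.2 y.1)) :=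
    (ENNReal.continuous_ofReal.comp (Real.continuous_exp.comp
      (((continuous_rotationDeriv hg).comp continuous_swap).const_mul _))).measurable
  calc ∫⁻ z, ENNReal.ofReal (Real.exp (g z.2 - g z.1)) ∂(μ.prod μ)
      ≤ ∫⁻ z, ∫⁻ θ, ENNReal.ofReal (Real.exp (Real.pi / 2 * rotationDeriv g θ z))
          ∂uniformQuarterTurn ∂(μ.prod μ) := by
        refine lintegral_mono fun z => ?_
        rw [← integral_rotationDeriv hg z]
        exact ofReal_exp_integral_le_lintegral ((integrable_rotationDeriv hg z).const_mul _)
    _ = ∫⁻ θ, ∫⁻ z, ENNReal.ofReal (Real.exp (Real.pi / 2 * rotationDeriv g θ z))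
          ∂(μ.prod μ) ∂uniformQuarterTurn :=
        lintegral_lintegral_swap hmeas.aemeasurable
    _ ≤ ∫⁻ _, ENNReal.ofReal (Real.exp (v * (Real.pi / 2 * K) ^ 2 / 2)) ∂uniformQuarterTurn :=
        lintegral_mono fun θ => lintegral_exp_mul_rotationDeriv_le hμ hv hg hgK _ θ
    _ = _ := by simp

end MaureyPisier

theorem subgaussianLipschitz_of_isGaussian {E : Type*} [NormedAddCommGroup E] [NormedSpace ℝ E]
    [FiniteDimensional ℝ E] [MeasurableSpace E] [BorelSpace E] {μ : Measure E} [IsGaussian μ]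
    (hμ : μ[id] = 0) {v : ℝ≥0} (hv : ∀ L : StrongDual ℝ E, Var[L; μ] ≤ v * ‖L‖ ^ 2) :
    SubgaussianLipschitz μ (NNReal.pi ^ 2 / 4 * v) := by
  intro K g hg
  have : CompleteSpace E := FiniteDimensional.complete ℝ E
  have : ProperSpace E := FiniteDimensional.proper ℝ E
  set c : ℝ := K ^ 2 * (NNReal.pi ^ 2 / 4 * v : ℝ≥0) / 2
  have hsmooth (δ : ℝ) (hδ : 0 < δ) : ∫⁻ z, ENNReal.ofReal (Real.exp (g z.2 - g z.1)) ∂(μ.prod μ)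
      ≤ ENNReal.ofReal (Real.exp (2 * δ + c)) := by
    obtain ⟨h, hdiff, hlip, hclose⟩ := exists_contDiff_lipschitzWith_abs_sub_le hg hδ
    calc ∫⁻ z, ENNReal.ofReal (Real.exp (g z.2 - g z.1)) ∂(μ.prod μ)
        ≤ ∫⁻ z, ENNReal.ofReal (Real.exp (2 * δ)) * ENNReal.ofReal (Real.exp (h z.2 - h z.1))
            ∂(μ.prod μ) := by
          refine lintegral_mono fun z => ?_
          rw [← ENNReal.ofReal_mul (Real.exp_pos _).le, ← Real.exp_add]
          gcongr
          linarith [abs_le.1 (hclose z.1), abs_le.1 (hclose z.2)]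
      _ = ENNReal.ofReal (Real.exp (2 * δ)) *
            ∫⁻ z, ENNReal.ofReal (Real.exp (h z.2 - h z.1)) ∂(μ.prod μ) :=
          lintegral_const_mul' _ _ ENNReal.ofReal_ne_top
      _ ≤ ENNReal.ofReal (Real.exp (2 * δ)) * ENNReal.ofReal (Real.exp c) := by
          gcongr
          refine (lintegral_exp_sub_le_of_contDiff hμ hv hdiff hlip).trans_eq ?_
          simp only [c, NNReal.coe_mul, NNReal.coe_div, NNReal.coe_pow, NNReal.coe_real_pi,
            NNReal.coe_ofNat]
          ring_nf
      _ = ENNReal.ofReal (Real.exp (2 * δ + c)) := by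
          rw [← ENNReal.ofReal_mul (Real.exp_pos _).le, ← Real.exp_add]
  have hcont : Continuous fun δ : ℝ => ENNReal.ofReal (Real.exp (2 * δ + c)) :=
    ENNReal.continuous_ofReal.comp (by fun_prop)
  have hlim := (hcont.tendsto 0).mono_left (nhdsWithin_le_nhds (s := Set.Ioi 0))
  simp only [mul_zero, zero_add] at hlim
  exact ge_of_tendsto hlim (eventually_nhdsWithin_of_forall hsmooth)

section ComplexGaussian

theorem dual_complex_apply (L : StrongDual ℝ ℂ) (z : ℂ) :
    L z = L 1 * z.re + L Complex.I * z.im := by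
  conv_lhs => rw [← Complex.re_add_im z, ← mul_one (z.re : ℂ), ← Complex.real_smul,
    ← Complex.real_smul, map_add, map_smul, map_smul]
  simp only [smul_eq_mul, mul_comm]

theorem complexGaussian_eq_map (p : ℝ≥0) :
    complexGaussian p = ((gaussianReal 0 (p / 2)).prod (gaussianReal 0 (p / 2))).map
      (Complex.equivRealProdCLM.symm : ℝ × ℝ →L[ℝ] ℂ) :=
  rfl

instance isGaussian_complexGaussian (p : ℝ≥0) : IsGaussian (complexGaussian p) := by
  rw [complexGaussian_eq_map]
  infer_instance

theorem variance_dual_complexGaussian (p : ℝ≥0) (L : StrongDual ℝ ℂ) :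
    Var[L; complexGaussian p] = (L 1 ^ 2 + L Complex.I ^ 2) * (p / 2) := by
  rw [complexGaussian_eq_map, variance_map (by fun_prop) (by fun_prop)]
  have hL : L ∘ (Complex.equivRealProdCLM.symm : ℝ × ℝ →L[ℝ] ℂ) =
      fun x : ℝ × ℝ => L 1 * id x.1 + L Complex.I * id x.2 := by
    ext x
    rw [Function.comp_apply, dual_complex_apply]
    simp
  rw [hL, variance_add_prod (X := fun x => L 1 * id x) (Y := fun x => L Complex.I * id x)
    (IsGaussian.memLp_two_id.const_mul _) (IsGaussian.memLp_two_id.const_mul _)]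
  simp only [variance_const_mul, variance_id_gaussianReal]
  push_cast
  ring

theorem integral_id_complexGaussian (p : ℝ≥0) : ∫ z, z ∂(complexGaussian p) = 0 := by
  have hmean : ∫ x, x ∂((gaussianReal 0 (p / 2)).prod (gaussianReal 0 (p / 2))) = 0 := by
    ext
    · rw [fst_integral IsGaussian.integrable_fun_id, integral_fun_fst (fun x : ℝ => x)]
      simp
    · rw [snd_integral IsGaussian.integrable_fun_id, integral_fun_snd (fun x : ℝ => x)]
      simp
  rw [complexGaussian_eq_map, integral_map (by fun_prop) (by fun_prop),
    ContinuousLinearMap.integral_comp_comm _ IsGaussian.integrable_fun_id, hmean, map_zero]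

theorem integral_dual_sq_complexGaussian (p : ℝ≥0) (L : StrongDual ℝ ℂ) :
    ∫ z, L z ^ 2 ∂(complexGaussian p) = (L 1 ^ 2 + L Complex.I ^ 2) * (p / 2) := by
  rw [← variance_dual_complexGaussian, variance_of_integral_eq_zero (by fun_prop)]
  rw [IsGaussian.integral_dual, integral_id_complexGaussian, map_zero]

theorem lintegral_norm_sq_complexGaussian (p : ℝ≥0) :
    ∫⁻ z, ENNReal.ofReal (‖z‖ ^ 2) ∂(complexGaussian p) = p := by
  have hint (L : StrongDual ℝ ℂ) : Integrable (fun z => L z ^ 2) (complexGaussian p) :=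
    (IsGaussian.memLp_dual _ L 2 (by simp)).integrable_sq
  have hnorm (z : ℂ) : ‖z‖ ^ 2 = Complex.reCLM z ^ 2 + Complex.imCLM z ^ 2 := by
    rw [Complex.sq_norm, Complex.normSq_apply, Complex.reCLM_apply, Complex.imCLM_apply, sq, sq]
  simp only [hnorm]
  rw [← ofReal_integral_eq_lintegral_ofReal ((hint Complex.reCLM).fun_add (hint Complex.imCLM))
    (ae_of_all _ fun z => add_nonneg (sq_nonneg _) (sq_nonneg _)),
    integral_add (hint _) (hint _), integral_dual_sq_complexGaussian,
    integral_dual_sq_complexGaussian]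
  simp

variable {ι : Type*} [Fintype ι]

theorem dual_euclideanSpace_apply [DecidableEq ι] (L : StrongDual ℝ (EuclideanSpace ℂ ι))
    (x : EuclideanSpace ℂ ι) :
    L x = ∑ i, (L (EuclideanSpace.single i 1) * (x i).re +
      L (EuclideanSpace.single i Complex.I) * (x i).im) := by
  have hx : x = ∑ i, ((x i).re • EuclideanSpace.single i (1 : ℂ) +
      (x i).im • EuclideanSpace.single i Complex.I) := by
    ext j
    simp [Finset.sum_add_distrib, Pi.single_apply]
  conv_lhs => rw [hx]
  simp only [map_sum, map_add, map_smul, smul_eq_mul, mul_comm]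

theorem sum_sq_dual_single_le [DecidableEq ι] (L : StrongDual ℝ (EuclideanSpace ℂ ι)) :
    ∑ i, (L (EuclideanSpace.single i 1) ^ 2 + L (EuclideanSpace.single i Complex.I) ^ 2)
      ≤ ‖L‖ ^ 2 := by
  let w : EuclideanSpace ℂ ι := WithLp.toLp 2 fun i =>
    ⟨L (EuclideanSpace.single i 1), L (EuclideanSpace.single i Complex.I)⟩
  have hLw : L w = ‖w‖ ^ 2 := by
    rw [dual_euclideanSpace_apply, EuclideanSpace.norm_sq_eq]
    simp [Complex.sq_norm, Complex.normSq_apply, w]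
  have hw : ‖w‖ ≤ ‖L‖ := by
    have h := (le_abs_self _).trans (L.le_opNorm w)
    rw [hLw, sq] at h
    rcases (norm_nonneg w).eq_or_lt with h0 | hpos
    · exact h0.symm.trans_le (norm_nonneg _)
    · exact le_of_mul_le_mul_right h hpos
  calc _ = ‖w‖ ^ 2 := by
        rw [EuclideanSpace.norm_sq_eq]
        simp only [Complex.sq_norm, Complex.normSq_apply, ← sq, w]
    _ ≤ ‖L‖ ^ 2 := by gcongr

theorem isGaussian_pi_complexGaussian (p : ι → ℝ≥0) :
    IsGaussian (Measure.pi fun i => complexGaussian (p i)) := by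
  have hcoord (i : ι) : HasGaussianLaw (fun x : ι → ℂ => x i)
      (Measure.pi fun i => complexGaussian (p i)) :=
    ⟨by rw [(measurePreserving_eval _ i).map_eq]; infer_instance⟩
  have hjoint := (iIndepFun.hasGaussianLaw hcoord (iIndepFun_pi (X := fun _ => id)
    fun _ => aemeasurable_id)).isGaussian_map
  simpa [Measure.map_id'] using hjoint

/-- The law of a vector with independent centred complex Gaussian coordinates of variances `p i`,
on the Euclidean space, whose norm is the one for which the dimension-free bounds hold. -/
noncomputable def euclideanComplexGaussian (p : ι → ℝ≥0) : Measure (EuclideanSpace ℂ ι) :=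
  (Measure.pi fun i => complexGaussian (p i)).map
    ((PiLp.continuousLinearEquiv 2 ℝ fun _ : ι => ℂ).symm : (ι → ℂ) →L[ℝ] EuclideanSpace ℂ ι)

instance isGaussian_euclideanComplexGaussian (p : ι → ℝ≥0) :
    IsGaussian (euclideanComplexGaussian p) := by
  have := isGaussian_pi_complexGaussian p
  unfold euclideanComplexGaussian
  infer_instance

theorem integral_id_euclideanComplexGaussian (p : ι → ℝ≥0) :
    ∫ x, id x ∂(euclideanComplexGaussian p) = 0 := by
  have := isGaussian_pi_complexGaussian p
  have hmean : ∫ x, x ∂(Measure.pi fun i => complexGaussian (p i)) = 0 := by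
    ext i
    rw [eval_integral fun i => integrable_eval IsGaussian.integrable_id]
    exact (integral_comp_eval (μ := fun i => complexGaussian (p i)) (i := i)
      (f := fun z => z) (by fun_prop)).trans
      (integral_id_complexGaussian (p i))
  rw [euclideanComplexGaussian, integral_map (by fun_prop) (by fun_prop)]
  simp only [id]
  rw [ContinuousLinearMap.integral_comp_comm _ IsGaussian.integrable_fun_id, hmean, map_zero]

theorem variance_dual_euclideanComplexGaussian [DecidableEq ι] (p : ι → ℝ≥0)
    (L : StrongDual ℝ (EuclideanSpace ℂ ι)) :
    Var[L; euclideanComplexGaussian p] = ∑ i, (L (EuclideanSpace.single i 1) ^ 2 +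
      L (EuclideanSpace.single i Complex.I) ^ 2) * (p i / 2) := by
  let A (i : ι) : StrongDual ℝ ℂ := L (EuclideanSpace.single i 1) • Complex.reCLM +
    L (EuclideanSpace.single i Complex.I) • Complex.imCLM
  have hL : L ∘ ((PiLp.continuousLinearEquiv 2 ℝ fun _ : ι => ℂ).symm :
      (ι → ℂ) →L[ℝ] EuclideanSpace ℂ ι) = ∑ i, fun x : ι → ℂ => A i (x i) := by
    ext x
    rw [Function.comp_apply, dual_euclideanSpace_apply]
    simp [A]
  rw [euclideanComplexGaussian, variance_map (by fun_prop) (by fun_prop), hL,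
    variance_sum_pi fun i => IsGaussian.memLp_dual _ (A i) 2 (by simp)]
  simp only [variance_dual_complexGaussian]
  simp [A]

theorem subgaussianLipschitz_euclideanComplexGaussian {p : ι → ℝ≥0} {P : ℝ≥0}
    (hp : ∀ i, p i ≤ P) :
    SubgaussianLipschitz (euclideanComplexGaussian p) (NNReal.pi ^ 2 / 4 * (P / 2)) := by
  classical
  refine subgaussianLipschitz_of_isGaussian (integral_id_euclideanComplexGaussian p) fun L => ?_
  rw [variance_dual_euclideanComplexGaussian]
  calc ∑ i, (L (EuclideanSpace.single i 1) ^ 2 +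
          L (EuclideanSpace.single i Complex.I) ^ 2) * (p i / 2 : ℝ)
      ≤ ∑ i, (L (EuclideanSpace.single i 1) ^ 2 +
          L (EuclideanSpace.single i Complex.I) ^ 2) * (P / 2 : ℝ) := by
        gcongr with i
        exact hp i
    _ ≤ ‖L‖ ^ 2 * (P / 2 : ℝ) := by
        rw [← Finset.sum_mul]
        gcongr
        exact sum_sq_dual_single_le L
    _ = (P / 2 : ℝ≥0) * ‖L‖ ^ 2 := by
        push_cast
        ring

end ComplexGaussian

section HilbertBases

variable {H : Type*} [NormedAddCommGroup H] [InnerProductSpace ℂ H] {ι : Type*}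

theorem countable_of_orthonormal [TopologicalSpace.SeparableSpace H] {v : ι → H}
    (hv : Orthonormal ℂ v) : Countable ι := by
  rw [← Set.countable_univ_iff]
  refine Set.PairwiseDisjoint.countable_of_isOpen (s := fun i => Metric.ball (v i) (1 / 2)) ?_
    (fun i _ => Metric.isOpen_ball) (fun i _ => ⟨v i, by simp⟩)
  intro i _ j _ hij
  refine Metric.ball_disjoint_ball ?_
  have h : dist (v i) (v j) ^ 2 = 2 := by
    rw [dist_eq_norm, norm_sub_sq (𝕜 := ℂ), hv.1, hv.1, hv.2 hij]
    norm_num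
  nlinarith [dist_nonneg (x := v i) (y := v j)]

variable (b : HilbertBasis ι ℂ H)

theorem tsum_ofReal_norm_inner_sq (x : H) :
    ∑' i, ENNReal.ofReal (‖⟪b i, x⟫_ℂ‖ ^ 2) = ENNReal.ofReal (‖x‖ ^ 2) := by
  have h := Complex.hasSum_re (b.hasSum_inner_mul_inner x x)
  have hterm (i : ι) : (⟪x, b i⟫_ℂ * ⟪b i, x⟫_ℂ).re = ‖⟪b i, x⟫_ℂ‖ ^ 2 := by
    rw [← inner_conj_symm, Complex.conj_mul']
    norm_cast
  have hsum : (⟪x, x⟫_ℂ).re = ‖x‖ ^ 2 := by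
    rw [inner_self_eq_norm_sq_to_K]
    norm_cast
  simp only [hterm, hsum] at h
  rw [← ENNReal.ofReal_tsum_of_nonneg (fun i => by positivity) h.summable, h.tsum_eq]

theorem hasSum_smul_hilbertBasis {z : ι → ℂ} (hz : ∑' n, ENNReal.ofReal (‖z n‖ ^ 2) ≠ ⊤) :
    HasSum (fun n => z n • b n) (∑' n, z n • b n) := by
  have hs : Summable fun n => ‖z n‖ ^ 2 :=
    (ENNReal.summable_toReal hz).congr fun n => ENNReal.toReal_ofReal (by positivity)
  have hmem : Memℓp z 2 := memℓp_gen (by simpa using hs)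
  exact (b.hasSum_repr_symm ⟨z, hmem⟩).summable.hasSum

theorem ofReal_norm_sq_of_hasSum_smul {z : ι → ℂ} {x : H} (hx : HasSum (fun n => z n • b n) x) :
    ENNReal.ofReal (‖x‖ ^ 2) = ∑' n, ENNReal.ofReal (‖z n‖ ^ 2) := by
  classical
  have hcoeff (n : ι) : ⟪b n, x⟫_ℂ = z n := by
    refine ((innerSL ℂ (b n)).hasSum hx).unique ?_
    simp only [innerSL_apply_apply, inner_smul_right, orthonormal_iff_ite.1 b.orthonormal,
      mul_ite, mul_one, mul_zero]
    simpa only [if_true] using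
      hasSum_single (f := fun k => if n = k then z k else 0) n fun k hk => if_neg hk.symm
  simp only [← tsum_ofReal_norm_inner_sq b, hcoeff]

theorem isometry_sum_smul_orthonormal {κ : Type*} [Fintype κ] {v : κ → H}
    (hv : Orthonormal ℂ v) : Isometry fun x : EuclideanSpace ℂ κ => ∑ n, x n • v n := by
  refine Isometry.of_dist_eq fun x y => ?_
  have hsub : ∑ n, x n • v n - ∑ n, y n • v n = ∑ n, (x - y) n • v n := by
    simp only [← Finset.sum_sub_distrib, ← sub_smul, PiLp.sub_apply]
  rw [dist_eq_norm, dist_eq_norm, hsub, ← sq_eq_sq₀ (norm_nonneg _) (norm_nonneg _),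
    EuclideanSpace.norm_sq_eq]
  have h := hv.inner_sum (x - y) (x - y) Finset.univ
  simp only [inner_self_eq_norm_sq_to_K, Complex.conj_mul'] at h
  exact Complex.ofReal_injective (by push_cast; exact h)

end HilbertBases

section DensityOperators

theorem EigenONB.eigenvalue_le_nnnorm {H : Type*} [NormedAddCommGroup H] [InnerProductSpace ℂ H]
    {T : H →L[ℂ] H} (e : EigenONB T) (n : e.index) : e.eigenvalue n ≤ ‖T‖₊ := by
  have h := T.le_opNorm (e.basis n)
  rw [e.apply_basis, norm_smul, e.basis.orthonormal.1] at h
  exact_mod_cast (by simpa using h : (e.eigenvalue n : ℝ) ≤ ‖T‖)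

theorem EigenONB.hasSum_eigenvalue_mul_norm_inner_sq {H : Type*} [NormedAddCommGroup H]
    [InnerProductSpace ℂ H] {T : H →L[ℂ] H} (e : EigenONB T)
    (hT : T.IsPositive) (x : H) :
    HasSum (fun n => (e.eigenvalue n : ℝ) * ‖⟪e.basis n, x⟫_ℂ‖ ^ 2) (⟪x, T x⟫_ℂ).re := by
  have h := Complex.hasSum_re (e.basis.hasSum_inner_mul_inner x (T x))
  convert h using 2 with n
  have hcoeff : ⟪e.basis n, T x⟫_ℂ = (e.eigenvalue n : ℝ) * ⟪e.basis n, x⟫_ℂ := by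
    rw [← hT.inner_left_eq_inner_right, e.apply_basis, inner_smul_left, Complex.conj_ofReal]
  rw [hcoeff, mul_left_comm, ← inner_conj_symm x, Complex.conj_mul']
  norm_cast

theorem EigenONB.ofReal_re_inner_eq_tsum {H : Type*} [NormedAddCommGroup H]
    [InnerProductSpace ℂ H] {T : H →L[ℂ] H} (e : EigenONB T)
    (hT : T.IsPositive) (x : H) :
    ENNReal.ofReal (⟪x, T x⟫_ℂ).re =
      ∑' n, (e.eigenvalue n : ℝ≥0∞) * ENNReal.ofReal (‖⟪e.basis n, x⟫_ℂ‖ ^ 2) := by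
  have h := e.hasSum_eigenvalue_mul_norm_inner_sq hT x
  rw [← h.tsum_eq, ENNReal.ofReal_tsum_of_nonneg (fun n => by positivity) h.summable]
  simp only [ENNReal.ofReal_mul NNReal.zero_le_coe, ENNReal.ofReal_coe_nnreal]

theorem DensityOperator.tsum_eigenvalue {H : Type*} [NormedAddCommGroup H] [InnerProductSpace ℂ H]
    [CompleteSpace H] (ρ : DensityOperator H) (e : EigenONB ρ.op) :
    ∑' n, (e.eigenvalue n : ℝ≥0∞) = 1 := by
  obtain ⟨w, b, hb⟩ := ρ.trace_eq_one
  have hre := Complex.hasSum_re hb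
  have hunit (n : e.index) : ∑' i, ENNReal.ofReal (‖⟪e.basis n, b i⟫_ℂ‖ ^ 2) = 1 := by
    simp only [norm_inner_symm _ (b _)]
    rw [tsum_ofReal_norm_inner_sq, e.basis.orthonormal.1]
    simp
  calc ∑' n, (e.eigenvalue n : ℝ≥0∞)
      = ∑' n, ∑' i, (e.eigenvalue n : ℝ≥0∞) * ENNReal.ofReal (‖⟪e.basis n, b i⟫_ℂ‖ ^ 2) := by
        simp only [ENNReal.tsum_mul_left, hunit, mul_one]
    _ = ∑' i, ∑' n, (e.eigenvalue n : ℝ≥0∞) * ENNReal.ofReal (‖⟪e.basis n, b i⟫_ℂ‖ ^ 2) :=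
        ENNReal.tsum_comm
    _ = ∑' i, ENNReal.ofReal (⟪b i, ρ.op (b i)⟫_ℂ).re := by
        simp only [e.ofReal_re_inner_eq_tsum ρ.isPositive]
    _ = 1 := by
        rw [← ENNReal.ofReal_tsum_of_nonneg (fun i =>
          (Complex.nonneg_iff.1 (ρ.isPositive.inner_nonneg_right (b i))).1)
          hre.summable, hre.tsum_eq, Complex.one_re, ENNReal.ofReal_one]

end DensityOperators

section GaussianSeries

variable {H : Type*} [NormedAddCommGroup H] [InnerProductSpace ℂ H]
  {ι : Type*} (b : HilbertBasis ι ℂ H) (p : ι → ℝ≥0)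

theorem lintegral_tsum_norm_sq_infinitePi [Countable ι] :
    ∫⁻ Z, ∑' n, ENNReal.ofReal (‖Z n‖ ^ 2) ∂(Measure.infinitePi fun n => complexGaussian (p n))
      = ∑' n, (p n : ℝ≥0∞) := by
  rw [lintegral_tsum fun n => (by fun_prop : Measurable _).aemeasurable]
  refine tsum_congr fun n => ?_
  rw [← lintegral_norm_sq_complexGaussian (p n), ← Measure.infinitePi_map_eval
    (fun n => complexGaussian (p n)) n, lintegral_map (by fun_prop) (by fun_prop)]

theorem ae_hasSum_smul_infinitePi [Countable ι] (hp : ∑' n, (p n : ℝ≥0∞) ≠ ⊤) :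
    ∀ᵐ Z ∂(Measure.infinitePi fun n => complexGaussian (p n)),
      HasSum (fun n => Z n • b n) (∑' n, Z n • b n) := by
  rw [← lintegral_tsum_norm_sq_infinitePi p] at hp
  filter_upwards [ae_lt_top' (AEMeasurable.tsum fun n =>
    (by fun_prop : Measurable _).aemeasurable) hp] with Z hZ
  exact hasSum_smul_hilbertBasis b hZ.ne

variable [MeasurableSpace H] [BorelSpace H]

theorem map_sum_smul_infinitePi (S : Finset ι) :
    (Measure.infinitePi fun n => complexGaussian (p n)).map (fun Z => ∑ n ∈ S, Z n • b n) =
      (euclideanComplexGaussian fun n : S => p n).map fun x => ∑ n : S, x n • b n := by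
  have hsum : Measurable fun x : EuclideanSpace ℂ S => ∑ n : S, x n • b n :=
    (by fun_prop : Continuous _).measurable
  rw [euclideanComplexGaussian, ← Measure.infinitePi_map_restrict (fun n => complexGaussian (p n)),
    Measure.map_map hsum (by fun_prop), Measure.map_map (hsum.comp (by fun_prop)) (by fun_prop)]
  congr 1 with Z
  exact (Finset.sum_coe_sort S fun n => Z n • b n).symm

theorem subgaussianLipschitz_map_sum_smul {P : ℝ≥0} (hP : ∀ n, p n ≤ P) (S : Finset ι) :
    SubgaussianLipschitz ((Measure.infinitePi fun n => complexGaussian (p n)).map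
      fun Z => ∑ n ∈ S, Z n • b n) (NNReal.pi ^ 2 / 4 * (P / 2)) := by
  rw [map_sum_smul_infinitePi]
  have hiso := isometry_sum_smul_orthonormal
    (b.orthonormal.comp ((↑) : S → ι) Subtype.val_injective)
  simpa using (subgaussianLipschitz_euclideanComplexGaussian fun n : S => hP n).map hiso.lipschitz

variable [TopologicalSpace.SeparableSpace H] [CompleteSpace H] [Countable ι]

theorem measurable_tsum_smul : Measurable fun Z : ι → ℂ => ∑' n, Z n • b n := by
  have := UniformSpace.secondCountable_of_separable H
  exact Measurable.tsum fun n => by fun_prop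

theorem subgaussianLipschitz_map_tsum_smul {P : ℝ≥0} (hP : ∀ n, p n ≤ P)
    (hp : ∑' n, (p n : ℝ≥0∞) ≠ ⊤) :
    SubgaussianLipschitz ((Measure.infinitePi fun n => complexGaussian (p n)).map
      fun Z => ∑' n, Z n • b n) (NNReal.pi ^ 2 / 4 * (P / 2)) := by
  have := UniformSpace.secondCountable_of_separable H
  obtain ⟨S, hS⟩ := Filter.exists_seq_tendsto (Filter.atTop : Filter (Finset ι))
  refine SubgaussianLipschitz.of_ae_tendsto (X := fun k Z => ∑ n ∈ S k, Z n • b n)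
    (fun k => by fun_prop) (measurable_tsum_smul b) ?_
    fun k => subgaussianLipschitz_map_sum_smul b p hP (S k)
  filter_upwards [ae_hasSum_smul_infinitePi b p hp] with Z hZ using hZ.comp hS

end GaussianSeries

section GaussianMeasure

variable {H : Type*} [NormedAddCommGroup H] [InnerProductSpace ℂ H] [CompleteSpace H]
  [TopologicalSpace.SeparableSpace H] [MeasurableSpace H] [BorelSpace H] (ρ : DensityOperator H)

instance isProbabilityMeasure_gaussianMeasure : IsProbabilityMeasure (gaussianMeasure ρ) := by
  have := countable_of_orthonormal ρ.eigenONB.basis.orthonormal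
  exact Measure.isProbabilityMeasure_map (measurable_tsum_smul ρ.eigenONB.basis).aemeasurable

theorem lintegral_norm_sq_gaussianMeasure :
    ∫⁻ ψ, ENNReal.ofReal (‖ψ‖ ^ 2) ∂(gaussianMeasure ρ) = 1 := by
  have := countable_of_orthonormal ρ.eigenONB.basis.orthonormal
  have hp := ρ.tsum_eigenvalue ρ.eigenONB
  rw [gaussianMeasure, lintegral_map (by fun_prop) (measurable_tsum_smul ρ.eigenONB.basis),
    ← hp, ← lintegral_tsum_norm_sq_infinitePi]
  refine lintegral_congr_ae ?_
  filter_upwards [ae_hasSum_smul_infinitePi ρ.eigenONB.basis ρ.eigenONB.eigenvalue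
    (by simp [hp])] with Z hZ using ofReal_norm_sq_of_hasSum_smul _ hZ

theorem subgaussianLipschitz_gaussianMeasure :
    SubgaussianLipschitz (gaussianMeasure ρ) (NNReal.pi ^ 2 / 4 * (‖ρ.op‖₊ / 2)) := by
  have := countable_of_orthonormal ρ.eigenONB.basis.orthonormal
  exact subgaussianLipschitz_map_tsum_smul _ _ ρ.eigenONB.eigenvalue_le_nnnorm
    (by simp [ρ.tsum_eigenvalue ρ.eigenONB])

end GaussianMeasure

section AdjustedMeasure

theorem sq_le_exp_two_mul_sub_one {x : ℝ} (hx : 0 ≤ x) : x ^ 2 ≤ Real.exp (2 * (x - 1)) := by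
  calc x ^ 2 ≤ Real.exp (x - 1) ^ 2 := by
        gcongr
        linarith [Real.add_one_le_exp (x - 1)]
    _ = Real.exp (2 * (x - 1)) := by rw [← Real.exp_nat_mul, Nat.cast_two]

variable {E : Type*} [NormedAddCommGroup E] [MeasurableSpace E]

/-- The adjustment of a measure: its density relative to `μ` is the squared norm, which makes
`gaMeasure` the adjustment of `gaussianMeasure`. It has total mass one when `μ` has second
moment one. -/
noncomputable def adjustedMeasure (μ : Measure E) : Measure E :=
  μ.withDensity fun x => ENNReal.ofReal (‖x‖ ^ 2)

variable [BorelSpace E] {μ : Measure E}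

theorem ae_ne_zero_adjustedMeasure : ∀ᵐ x ∂(adjustedMeasure μ), x ≠ 0 := by
  rw [adjustedMeasure, ae_withDensity_iff (by fun_prop)]
  exact ae_of_all _ fun x hx h0 => hx (by simp [h0])

theorem integral_adjustedMeasure (q : E → ℝ) :
    ∫ x, q x ∂(adjustedMeasure μ) = ∫ x, ‖x‖ ^ 2 * q x ∂μ := by
  rw [adjustedMeasure, integral_withDensity_eq_integral_toReal_smul (by fun_prop)
    (ae_of_all _ fun _ => ENNReal.ofReal_lt_top)]
  simp only [smul_eq_mul, ENNReal.toReal_ofReal (sq_nonneg _)]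

theorem integrable_norm_sq_mul {q : E → ℝ} (hq : Integrable q (adjustedMeasure μ)) :
    Integrable (fun x => ‖x‖ ^ 2 * q x) μ := by
  rw [adjustedMeasure, integrable_withDensity_iff_integrable_smul' (by fun_prop)
    (ae_of_all _ fun _ => ENNReal.ofReal_lt_top)] at hq
  simpa only [smul_eq_mul, ENNReal.toReal_ofReal (sq_nonneg _)] using hq

section Moments

variable [IsProbabilityMeasure (adjustedMeasure μ)]

theorem memLp_norm_of_adjustedMeasure : MemLp (fun x => ‖x‖) 2 μ := by
  rw [memLp_two_iff_integrable_sq (by fun_prop)]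
  simpa only [mul_one] using integrable_norm_sq_mul (integrable_const (μ := adjustedMeasure μ) 1)

theorem integral_norm_sq_of_adjustedMeasure : ∫ x, ‖x‖ ^ 2 ∂μ = 1 := by
  simpa using (integral_adjustedMeasure (μ := μ) fun _ => 1).symm

variable [IsProbabilityMeasure μ]

theorem integral_sub_norm_sq_of_adjustedMeasure (a : ℝ) :
    ∫ x, (‖x‖ - a) ^ 2 ∂μ = 1 - 2 * a * ∫ x, ‖x‖ ∂μ + a ^ 2 := by
  have hnorm : MemLp (fun x => ‖x‖) 2 μ := memLp_norm_of_adjustedMeasure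
  have hlin : Integrable (fun x => 2 * a * ‖x‖) μ := (hnorm.integrable (by simp)).const_mul _
  have hdiff : Integrable (fun x => ‖x‖ ^ 2 - 2 * a * ‖x‖) μ := hnorm.integrable_sq.sub hlin
  have hexpand (x : E) : (‖x‖ - a) ^ 2 = ‖x‖ ^ 2 - 2 * a * ‖x‖ + a ^ 2 := by ring
  simp only [hexpand]
  rw [integral_add hdiff (integrable_const _),
    integral_sub hnorm.integrable_sq hlin, integral_const_mul,
    integral_norm_sq_of_adjustedMeasure]
  simp

theorem integral_norm_le_one_of_adjustedMeasure : ∫ x, ‖x‖ ∂μ ≤ 1 := by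
  have h : 0 ≤ ∫ x, (‖x‖ - ∫ y, ‖y‖ ∂μ) ^ 2 ∂μ := integral_nonneg fun x => sq_nonneg _
  rw [integral_sub_norm_sq_of_adjustedMeasure] at h
  exact le_of_sq_le_sq (by linarith) zero_le_one

variable {v : ℝ≥0}

theorem SubgaussianLipschitz.one_sub_le_integral_norm (h : SubgaussianLipschitz μ v) :
    1 - 2 * v ≤ ∫ x, ‖x‖ ∂μ := by
  have hvar := integral_sq_le_of_hasSubgaussianMGF
    (h.hasSubgaussianMGF_sub_integral lipschitzWith_one_norm)
  rw [integral_sub_norm_sq_of_adjustedMeasure] at hvar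
  have hmean : 0 ≤ ∫ x, ‖x‖ ∂μ := integral_nonneg fun x => norm_nonneg x
  have hmean_le : ∫ x, ‖x‖ ∂μ ≤ 1 := integral_norm_le_one_of_adjustedMeasure
  push_cast at hvar
  nlinarith

theorem SubgaussianLipschitz.integral_norm_sub_one_sq_le (h : SubgaussianLipschitz μ v) :
    ∫ x, (‖x‖ - 1) ^ 2 ∂μ ≤ 4 * (v : ℝ) := by
  rw [integral_sub_norm_sq_of_adjustedMeasure]
  linarith [h.one_sub_le_integral_norm]

-- The density is absorbed into the exponent: `‖x‖ ^ 2 ≤ exp (2 * (‖x‖ - 1))`, and the mean of the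
-- norm is at most one.
theorem SubgaussianLipschitz.adjustedMeasure_nonneg_le (h : SubgaussianLipschitz μ v) {K : ℝ≥0}
    {F : E → ℝ} (hF : LipschitzWith K F) :
    adjustedMeasure μ {x | 0 ≤ F x} ≤
      ENNReal.ofReal (Real.exp (∫ x, F x ∂μ + (K + 2) ^ 2 * v / 2)) := by
  have hG : LipschitzWith (K + 2) fun x => F x + 2 * ‖x‖ := by
    simpa only [two_mul, one_add_one_eq_two] using
      hF.add (lipschitzWith_one_norm.add lipschitzWith_one_norm)
  have hmean : ∫ x, (F x + 2 * ‖x‖) ∂μ ≤ ∫ x, F x ∂μ + 2 := by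
    rw [integral_add (h.integrable hF) ((h.integrable lipschitzWith_one_norm).const_mul _),
      integral_const_mul]
    linarith [integral_norm_le_one_of_adjustedMeasure (μ := μ)]
  have hsub := h.hasSubgaussianMGF_sub_integral hG
  set m := ∫ x, (F x + 2 * ‖x‖) ∂μ
  have hpointwise (x : E) (hx : 0 ≤ F x) :
      ‖x‖ ^ 2 ≤ Real.exp (∫ x, F x ∂μ) * Real.exp (1 * (F x + 2 * ‖x‖ - m)) := by
    refine (sq_le_exp_two_mul_sub_one (norm_nonneg x)).trans ?_
    rw [← Real.exp_add, Real.exp_le_exp]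
    linarith
  have hmeas : MeasurableSet {x | 0 ≤ F x} :=
    measurableSet_le measurable_const hF.continuous.measurable
  calc adjustedMeasure μ {x | 0 ≤ F x} = ∫⁻ x in {x | 0 ≤ F x}, ENNReal.ofReal (‖x‖ ^ 2) ∂μ :=
        withDensity_apply _ hmeas
    _ ≤ ∫⁻ x, ENNReal.ofReal
          (Real.exp (∫ x, F x ∂μ) * Real.exp (1 * (F x + 2 * ‖x‖ - m))) ∂μ :=
        (setLIntegral_mono' hmeas fun x hx => ENNReal.ofReal_le_ofReal (hpointwise x hx)).trans
          (setLIntegral_le_lintegral _ _)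
    _ = ENNReal.ofReal (Real.exp (∫ x, F x ∂μ) * mgf (fun x => F x + 2 * ‖x‖ - m) μ 1) := by
        rw [← ofReal_integral_eq_lintegral_ofReal ((hsub.integrable_exp_mul 1).const_mul _)
          (ae_of_all _ fun x => by positivity), integral_const_mul, mgf]
    _ ≤ _ := by
        rw [Real.exp_add]
        gcongr
        simpa using hsub.mgf_le 1

end Moments

end AdjustedMeasure

theorem mul_sub_sq_mul_le {ε : ℝ} (hε : 0 < ε) (a d : ℝ) :
    a * d - a ^ 2 * d ≤ ε / 4 * a ^ 2 + d ^ 2 / ε * (a - 1) ^ 2 := by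
  have hsq : 0 ≤ (ε / 2 * a + (a - 1) * d) ^ 2 / ε := by positivity
  have hexpand : (ε / 2 * a + (a - 1) * d) ^ 2 / ε =
      ε / 4 * a ^ 2 + d ^ 2 / ε * (a - 1) ^ 2 - (a * d - a ^ 2 * d) := by
    field_simp
    ring
  linarith

theorem le_one_of_mul_sq_le {a b c : ℝ} (hb : 0 < b) (hbc : b ≤ c) (h : a * c ^ 2 ≤ b ^ 2) :
    a ≤ 1 := by
  by_contra! ha
  have hlt : b ^ 2 < a * b ^ 2 := lt_mul_of_one_lt_left (by positivity) ha
  have hle : a * b ^ 2 ≤ a * c ^ 2 := by gcongr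
  linarith

/-- A function that oscillates by at most `B` and is Lipschitz with constant `B / ‖x‖` at distance
`‖x‖` from the origin; Lipschitz functions of the direction `x / ‖x‖` are of this kind. -/
structure AngularLipschitz {E : Type*} [NormedAddCommGroup E] (B : ℝ≥0) (q : E → ℝ) : Prop where
  abs_sub_le : ∀ x y, |q x - q y| ≤ B
  norm_mul_abs_sub_le : ∀ x y, ‖x‖ * |q x - q y| ≤ B * ‖x - y‖

namespace AngularLipschitz

variable {E : Type*} [NormedAddCommGroup E] {B : ℝ≥0} {q : E → ℝ}

theorem neg (hq : AngularLipschitz B q) : AngularLipschitz B (-q) where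
  abs_sub_le x y := by
    simpa only [Pi.neg_apply, neg_sub_neg, abs_sub_comm] using hq.abs_sub_le y x
  norm_mul_abs_sub_le x y := by
    simpa only [Pi.neg_apply, neg_sub_neg, abs_sub_comm] using hq.norm_mul_abs_sub_le x y

theorem lipschitzWith_norm_mul_sub (hq : AngularLipschitz B q) {a : ℝ} {M : ℝ≥0}
    (hM : ∀ x, |q x - a| ≤ M) : LipschitzWith (M + B) fun x => ‖x‖ * (q x - a) := by
  refine LipschitzWith.of_dist_le_mul fun x y => ?_
  rw [Real.dist_eq, dist_eq_norm]
  calc |‖x‖ * (q x - a) - ‖y‖ * (q y - a)|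
      = |(‖x‖ - ‖y‖) * (q y - a) + ‖x‖ * (q x - q y)| := by ring_nf
    _ ≤ |‖x‖ - ‖y‖| * |q y - a| + ‖x‖ * |q x - q y| := by
        rw [← abs_mul, ← abs_norm x, ← abs_mul, abs_norm]
        exact abs_add_le _ _
    _ ≤ ‖x - y‖ * M + B * ‖x - y‖ :=
        add_le_add
          (mul_le_mul (abs_norm_sub_norm_le x y) (hM y) (abs_nonneg _) (norm_nonneg _))
          (hq.norm_mul_abs_sub_le x y)
    _ = (M + B : ℝ≥0) * ‖x - y‖ := by
        push_cast
        ring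

theorem continuousOn (hq : AngularLipschitz B q) : ContinuousOn q {0}ᶜ := by
  intro x hx
  refine (continuousAt_of_locally_lipschitz one_pos (B / ‖x‖) fun y _ => ?_).continuousWithinAt
  rw [Real.dist_eq, abs_sub_comm, dist_eq_norm, norm_sub_rev, div_mul_eq_mul_div,
    le_div_iff₀ (norm_pos_iff.2 hx), mul_comm]
  exact hq.norm_mul_abs_sub_le x y

variable [MeasurableSpace E] [BorelSpace E]

theorem measurable (hq : AngularLipschitz B q) : Measurable q :=
  measurable_of_continuousOn_compl_singleton 0 hq.continuousOn

theorem integrable (hq : AngularLipschitz B q) (ν : Measure E) [IsFiniteMeasure ν] :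
    Integrable q ν := by
  refine Integrable.of_bound hq.measurable.aestronglyMeasurable (|q 0| + B)
    (ae_of_all _ fun x => ?_)
  rw [Real.norm_eq_abs]
  linarith [hq.abs_sub_le x 0, abs_sub_abs_le_abs_sub (q x) (q 0)]

theorem abs_sub_integral_le (hq : AngularLipschitz B q) (ν : Measure E) [IsProbabilityMeasure ν]
    (x : E) : |q x - ∫ y, q y ∂ν| ≤ B := by
  have hsub : q x - ∫ y, q y ∂ν = ∫ y, (q x - q y) ∂ν := by
    rw [integral_sub (integrable_const _) (hq.integrable ν)]
    simp
  rw [hsub, ← Real.norm_eq_abs]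
  simpa using norm_integral_le_of_norm_le_const (μ := ν) (f := fun y => q x - q y) (C := B)
    (ae_of_all _ fun y => hq.abs_sub_le x y)

variable {μ : Measure E} [IsProbabilityMeasure μ] [IsProbabilityMeasure (adjustedMeasure μ)]
  {v : ℝ≥0} {ε : ℝ}

-- The centred function has mean zero for the weight `‖x‖ ^ 2`, which is close to the weight `‖x‖`
-- because `‖x‖` concentrates near one.
theorem integral_norm_mul_sub_integral_le (hq : AngularLipschitz B q)
    (h : SubgaussianLipschitz μ v) (hε : 0 < ε) :
    ∫ x, ‖x‖ * (q x - ∫ y, q y ∂(adjustedMeasure μ)) ∂μ ≤ ε / 4 + 4 * B ^ 2 * v / ε := by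
  set m := ∫ y, q y ∂(adjustedMeasure μ)
  have hbound := hq.abs_sub_integral_le (adjustedMeasure μ)
  have hnorm : MemLp (fun x => ‖x‖) 2 μ := memLp_norm_of_adjustedMeasure
  have hnorm_sub : Integrable (fun x => (‖x‖ - 1) ^ 2) μ :=
    (hnorm.sub (memLp_const 1)).integrable_sq
  have hlin : Integrable (fun x => ‖x‖ * (q x - m)) μ :=
    h.integrable (hq.lipschitzWith_norm_mul_sub hbound)
  have hqm : Integrable (fun x => q x - m) (adjustedMeasure μ) :=
    (hq.integrable _).sub (integrable_const _)
  have hzero : ∫ x, ‖x‖ ^ 2 * (q x - m) ∂μ = 0 := by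
    rw [← integral_adjustedMeasure, integral_sub (hq.integrable _) (integrable_const _)]
    simp [m]
  have hpointwise (x : E) : ‖x‖ * (q x - m) - ‖x‖ ^ 2 * (q x - m) ≤
      ε / 4 * ‖x‖ ^ 2 + B ^ 2 / ε * (‖x‖ - 1) ^ 2 := by
    refine (mul_sub_sq_mul_le hε ‖x‖ (q x - m)).trans ?_
    have hsq : (q x - m) ^ 2 ≤ B ^ 2 := sq_le_sq.2 (by simpa using hbound x)
    gcongr
  calc ∫ x, ‖x‖ * (q x - m) ∂μ
      = ∫ x, (‖x‖ * (q x - m) - ‖x‖ ^ 2 * (q x - m)) ∂μ := by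
        rw [integral_sub hlin (integrable_norm_sq_mul hqm), hzero, sub_zero]
    _ ≤ ∫ x, (ε / 4 * ‖x‖ ^ 2 + B ^ 2 / ε * (‖x‖ - 1) ^ 2) ∂μ :=
        integral_mono (hlin.sub (integrable_norm_sq_mul hqm))
          ((hnorm.integrable_sq.const_mul _).add (hnorm_sub.const_mul _)) hpointwise
    _ = ε / 4 + B ^ 2 / ε * ∫ x, (‖x‖ - 1) ^ 2 ∂μ := by
        rw [integral_add (hnorm.integrable_sq.const_mul _) (hnorm_sub.const_mul _),
          integral_const_mul, integral_const_mul, integral_norm_sq_of_adjustedMeasure, mul_one]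
    _ ≤ ε / 4 + B ^ 2 / ε * (4 * v) := by
        gcongr
        exact h.integral_norm_sub_one_sq_le
    _ = ε / 4 + 4 * B ^ 2 * v / ε := by ring

theorem integral_norm_mul_sub_integral_sub_le (hq : AngularLipschitz B q)
    (h : SubgaussianLipschitz μ v) (hε : 0 < ε) (hεB : ε ≤ B) (hv : 144 * B ^ 2 * v ≤ ε ^ 2) :
    ∫ x, ‖x‖ * (q x - (∫ y, q y ∂(adjustedMeasure μ) + ε)) ∂μ ≤ -(ε / 2) := by
  set m := ∫ y, q y ∂(adjustedMeasure μ)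
  have hlin : Integrable (fun x => ‖x‖ * (q x - m)) μ :=
    h.integrable (hq.lipschitzWith_norm_mul_sub (hq.abs_sub_integral_le (adjustedMeasure μ)))
  have hsplit : ∫ x, ‖x‖ * (q x - (m + ε)) ∂μ = ∫ x, ‖x‖ * (q x - m) ∂μ - ε * ∫ x, ‖x‖ ∂μ := by
    rw [← integral_const_mul, ← integral_sub hlin
      ((h.integrable lipschitzWith_one_norm).const_mul _)]
    refine integral_congr_ae (ae_of_all _ fun x => ?_)
    ring
  have hv_le : 144 * (v : ℝ) ≤ 1 := le_one_of_mul_sq_le hε hεB (by linarith)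
  have hquot : 4 * B ^ 2 * v / ε ≤ ε / 36 := by
    rw [div_le_iff₀ hε]
    linarith
  have hmean : ε * (71 / 72) ≤ ε * ∫ x, ‖x‖ ∂μ := by
    gcongr
    linarith [h.one_sub_le_integral_norm]
  linarith [hq.integral_norm_mul_sub_integral_le h hε]

-- Chernoff's bound for the homogeneous extension of `q - m - ε`, with the parameter
-- `t = ε / (36 * B ^ 2 * v)` minimising `-t * ε / 2 + 9 * B ^ 2 * t ^ 2 * v`.
theorem adjustedMeasure_lt_sub_integral_le_exp (hq : AngularLipschitz B q)
    (h : SubgaussianLipschitz μ v) (hε : 0 < ε) (hεB : ε ≤ B) (hv : 144 * B ^ 2 * v ≤ ε ^ 2)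
    (hv0 : v ≠ 0) :
    adjustedMeasure μ {x | ε < q x - ∫ y, q y ∂(adjustedMeasure μ)} ≤
      ENNReal.ofReal (3 * Real.exp (-(ε ^ 2 / (144 * B ^ 2 * v)))) := by
  have hB : (0 : ℝ) < B := hε.trans_le hεB
  have hv_pos : (0 : ℝ) < v := NNReal.coe_pos.2 (pos_iff_ne_zero.2 hv0)
  have hv_le : 144 * (v : ℝ) ≤ 1 := le_one_of_mul_sq_le hε hεB (by linarith)
  have hbound (x : E) : |q x - (∫ y, q y ∂(adjustedMeasure μ) + ε)| ≤ (2 * B : ℝ≥0) := by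
    have hdev := abs_le.1 (hq.abs_sub_integral_le (adjustedMeasure μ) x)
    push_cast
    exact abs_le.2 ⟨by linarith, by linarith⟩
  have hmean := hq.integral_norm_mul_sub_integral_sub_le h hε hεB hv
  set m := ∫ y, q y ∂(adjustedMeasure μ)
  set t : ℝ := ε / (36 * B ^ 2 * v) with ht_def
  have ht : 0 < t := by positivity
  have hF : LipschitzWith (‖t‖₊ * (2 * B + B)) fun x => t * (‖x‖ * (q x - (m + ε))) :=
    (lipschitzWith_smul t).comp (hq.lipschitzWith_norm_mul_sub hbound)
  calc adjustedMeasure μ {x | ε < q x - m}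
      ≤ adjustedMeasure μ {x | 0 ≤ t * (‖x‖ * (q x - (m + ε)))} :=
        measure_mono fun x (hx : ε < q x - m) =>
          mul_nonneg ht.le (mul_nonneg (norm_nonneg x) (by linarith))
    _ ≤ ENNReal.ofReal (Real.exp (∫ x, t * (‖x‖ * (q x - (m + ε))) ∂μ +
          (t * (2 * B + B) + 2) ^ 2 * v / 2)) := by
        simpa [abs_of_pos ht] using h.adjustedMeasure_nonneg_le hF
    _ ≤ ENNReal.ofReal (Real.exp (1 + -(ε ^ 2 / (144 * B ^ 2 * v)))) := by
        refine ENNReal.ofReal_le_ofReal (Real.exp_le_exp.2 ?_)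
        rw [integral_const_mul]
        have hsq : (t * (2 * B + B) + 2) ^ 2 * v ≤ 2 * ((t * (2 * B + B)) ^ 2 + 2 ^ 2) * v := by
          gcongr
          exact add_sq_le
        have hopt : t * -(ε / 2) + (t * (2 * B + B)) ^ 2 * v = -(ε ^ 2 / (144 * B ^ 2 * v)) := by
          rw [ht_def]
          field_simp
          ring
        linarith [mul_le_mul_of_nonneg_left hmean ht.le]
    _ ≤ ENNReal.ofReal (3 * Real.exp (-(ε ^ 2 / (144 * B ^ 2 * v)))) := by
        rw [Real.exp_add]
        gcongr
        exact Real.exp_one_lt_three.le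

theorem adjustedMeasure_lt_sub_integral_le (hq : AngularLipschitz B q)
    (h : SubgaussianLipschitz μ v) (hε : 0 ≤ ε) :
    adjustedMeasure μ {x | ε < q x - ∫ y, q y ∂(adjustedMeasure μ)} ≤
      ENNReal.ofReal (3 * Real.exp (-(ε ^ 2 / (144 * B ^ 2 * v)))) := by
  rcases le_or_gt (ε ^ 2 / (144 * B ^ 2 * v)) 1 with hsmall | hlarge
  · refine prob_le_one.trans (ENNReal.one_le_ofReal.2 ?_)
    have hexp : Real.exp (-1) ≤ Real.exp (-(ε ^ 2 / (144 * B ^ 2 * v))) := by gcongr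
    linarith [Real.exp_neg_one_gt_d9]
  have hden : (144 * B ^ 2 * v : ℝ) ≠ 0 := fun h0 => by
    rw [h0, div_zero] at hlarge
    exact zero_lt_one.not_gt hlarge
  have hv0 : v ≠ 0 := fun h0 => hden (by simp [h0])
  have hv : 144 * B ^ 2 * v ≤ ε ^ 2 := ((one_lt_div (by positivity)).1 hlarge).le
  rcases le_or_gt ε B with hεB | hBε
  · refine hq.adjustedMeasure_lt_sub_integral_le_exp h (hε.lt_of_ne' fun h0 => ?_) hεB hv hv0
    norm_num [h0] at hlarge
  · have hempty : {x | ε < q x - ∫ y, q y ∂(adjustedMeasure μ)} = ∅ :=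
      Set.eq_empty_of_forall_notMem fun x hx =>
        ((le_abs_self _).trans (hq.abs_sub_integral_le _ x)).not_gt (hBε.trans hx)
    simp only [hempty, measure_empty, zero_le]

theorem adjustedMeasure_lt_abs_sub_integral_le (hq : AngularLipschitz B q)
    (h : SubgaussianLipschitz μ v) (hε : 0 ≤ ε) :
    adjustedMeasure μ {x | ε < |q x - ∫ y, q y ∂(adjustedMeasure μ)|} ≤
      ENNReal.ofReal (6 * Real.exp (-(ε ^ 2 / (144 * B ^ 2 * v)))) := by
  have hneg := hq.neg.adjustedMeasure_lt_sub_integral_le h hε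
  simp only [Pi.neg_apply, integral_neg, neg_sub_neg] at hneg
  simp only [lt_abs, neg_sub]
  refine (measure_union_le _ _).trans
    ((add_le_add (hq.adjustedMeasure_lt_sub_integral_le h hε) hneg).trans_eq ?_)
  rw [← ENNReal.ofReal_add (by positivity) (by positivity)]
  ring_nf

end AngularLipschitz

section Sphere

variable {H : Type*} [NormedAddCommGroup H] [InnerProductSpace ℂ H]

theorem abs_re_inner_le_one (ψ φ : Metric.sphere (0 : H) 1) :
    |(⟪(ψ : H), (φ : H)⟫_ℂ).re| ≤ 1 := by
  simpa using (Complex.abs_re_le_norm _).trans (norm_inner_le_norm (𝕜 := ℂ) (ψ : H) (φ : H))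

theorem cos_sphericalDist (ψ φ : Metric.sphere (0 : H) 1) :
    Real.cos (sphericalDist ψ φ) = (⟪(ψ : H), (φ : H)⟫_ℂ).re := by
  obtain ⟨hlower, hupper⟩ := abs_le.1 (abs_re_inner_le_one ψ φ)
  exact Real.cos_arccos hlower hupper

theorem sphericalDist_nonneg (ψ φ : Metric.sphere (0 : H) 1) : 0 ≤ sphericalDist ψ φ :=
  Real.arccos_nonneg _

theorem sphericalDist_le_pi (ψ φ : Metric.sphere (0 : H) 1) : sphericalDist ψ φ ≤ Real.pi :=
  Real.arccos_le_pi _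

theorem norm_sub_sq_eq_two_sub_cos_sphericalDist (ψ φ : Metric.sphere (0 : H) 1) :
    ‖(ψ : H) - φ‖ ^ 2 = 2 - 2 * Real.cos (sphericalDist ψ φ) := by
  rw [norm_sub_sq (𝕜 := ℂ), cos_sphericalDist, norm_eq_of_mem_sphere, norm_eq_of_mem_sphere,
    RCLike.re_to_complex]
  ring

theorem sphericalDist_le_norm_sub (ψ φ : Metric.sphere (0 : H) 1) :
    sphericalDist ψ φ ≤ Real.pi / 2 * ‖(ψ : H) - φ‖ := by
  have hcos := Real.cos_le_one_sub_mul_cos_sq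
    ((abs_of_nonneg (sphericalDist_nonneg ψ φ)).trans_le (sphericalDist_le_pi ψ φ))
  refine le_of_sq_le_sq ?_ (by positivity)
  rw [mul_pow, norm_sub_sq_eq_two_sub_cos_sphericalDist]
  calc sphericalDist ψ φ ^ 2
      = (Real.pi / 2) ^ 2 * (2 * (2 / Real.pi ^ 2 * sphericalDist ψ φ ^ 2)) := by field_simp
    _ ≤ (Real.pi / 2) ^ 2 * (2 - 2 * Real.cos (sphericalDist ψ φ)) := by
        gcongr
        linarith

open Classical in
/-- The radial projection to the unit sphere, with the value `s₀` at the origin. It realises `GAP`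
as the image of `GA` under a map into the sphere. -/
noncomputable def toSphere (s₀ : Metric.sphere (0 : H) 1) (ψ : H) : Metric.sphere (0 : H) 1 :=
  if h : ψ = 0 then s₀ else ⟨((‖ψ‖⁻¹ : ℝ) : ℂ) • ψ, by
    rw [mem_sphere_zero_iff_norm, norm_smul, Complex.norm_real, norm_inv, norm_norm,
      inv_mul_cancel₀ (norm_ne_zero_iff.2 h)]⟩

variable (s₀ : Metric.sphere (0 : H) 1)

theorem coe_toSphere {ψ : H} (h : ψ ≠ 0) : (toSphere s₀ ψ : H) = ((‖ψ‖⁻¹ : ℝ) : ℂ) • ψ := by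
  simp [toSphere, h]

theorem norm_smul_toSphere (ψ : H) : (‖ψ‖ : ℂ) • (toSphere s₀ ψ : H) = ψ := by
  rcases eq_or_ne ψ 0 with rfl | h
  · simp
  · rw [coe_toSphere s₀ h, smul_smul, ← Complex.ofReal_mul, mul_inv_cancel₀ (norm_ne_zero_iff.2 h),
      Complex.ofReal_one, one_smul]

theorem measurable_toSphere [SecondCountableTopology H] [MeasurableSpace H] [BorelSpace H] :
    Measurable (toSphere s₀) := by
  classical
  rw [← (MeasurableEmbedding.subtype_coe
    (Metric.isClosed_sphere (x := (0 : H)) (ε := 1)).measurableSet).measurable_comp_iff]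
  have hcoe : ((↑) : Metric.sphere (0 : H) 1 → H) ∘ toSphere s₀ =
      fun ψ => if ψ = 0 then (s₀ : H) else ((‖ψ‖⁻¹ : ℝ) : ℂ) • ψ := by
    ext ψ
    by_cases hψ : ψ = 0 <;> simp [toSphere, hψ]
  rw [hcoe]
  exact Measurable.ite (measurableSet_singleton 0) measurable_const (by fun_prop)

theorem norm_mul_norm_toSphere_sub_le (ψ φ : H) :
    ‖ψ‖ * ‖(toSphere s₀ ψ : H) - toSphere s₀ φ‖ ≤ 2 * ‖ψ - φ‖ := by
  have hsplit : (‖ψ‖ : ℂ) • ((toSphere s₀ ψ : H) - toSphere s₀ φ) =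
      (ψ - φ) + ((‖φ‖ : ℂ) - ‖ψ‖) • (toSphere s₀ φ : H) := by
    rw [smul_sub, sub_smul, norm_smul_toSphere, norm_smul_toSphere]
    abel
  calc ‖ψ‖ * ‖(toSphere s₀ ψ : H) - toSphere s₀ φ‖
      = ‖(ψ - φ) + ((‖φ‖ : ℂ) - ‖ψ‖) • (toSphere s₀ φ : H)‖ := by
        rw [← hsplit, norm_smul, Complex.norm_real, norm_norm]
    _ ≤ ‖ψ - φ‖ + |‖φ‖ - ‖ψ‖| := by
        refine (norm_add_le _ _).trans_eq ?_
        rw [norm_smul, norm_eq_of_mem_sphere, mul_one, ← Complex.ofReal_sub, Complex.norm_real,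
          Real.norm_eq_abs]
    _ ≤ 2 * ‖ψ - φ‖ := by
        rw [two_mul, norm_sub_rev ψ φ]
        gcongr
        exact abs_norm_sub_norm_le φ ψ

variable {f : Metric.sphere (0 : H) 1 → ℝ} {η : ℝ≥0}

theorem continuous_of_abs_sub_le_sphericalDist
    (hf : ∀ ψ φ, |f ψ - f φ| ≤ η * sphericalDist ψ φ) : Continuous f := by
  refine (LipschitzWith.of_dist_le_mul (K := η * (NNReal.pi / 2)) fun ψ φ => ?_).continuous
  rw [Real.dist_eq, Subtype.dist_eq, dist_eq_norm, NNReal.coe_mul, mul_assoc]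
  exact (hf ψ φ).trans (mul_le_mul_of_nonneg_left (sphericalDist_le_norm_sub ψ φ) η.2)

theorem angularLipschitz_comp_toSphere (hf : ∀ ψ φ, |f ψ - f φ| ≤ η * sphericalDist ψ φ) :
    AngularLipschitz (NNReal.pi * η) (f ∘ toSphere s₀) where
  abs_sub_le ψ φ := by
    rw [mul_comm, NNReal.coe_mul]
    exact (hf _ _).trans (mul_le_mul_of_nonneg_left (sphericalDist_le_pi _ _) η.2)
  norm_mul_abs_sub_le ψ φ := by
    have hdist := mul_le_mul_of_nonneg_left (norm_mul_norm_toSphere_sub_le s₀ ψ φ)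
      (by positivity : 0 ≤ η * (Real.pi / 2))
    calc ‖ψ‖ * |f (toSphere s₀ ψ) - f (toSphere s₀ φ)|
        ≤ ‖ψ‖ * (η * (Real.pi / 2 * ‖(toSphere s₀ ψ : H) - toSphere s₀ φ‖)) := by
          gcongr
          exact (hf _ _).trans (mul_le_mul_of_nonneg_left (sphericalDist_le_norm_sub _ _) η.2)
      _ = η * (Real.pi / 2) * (‖ψ‖ * ‖(toSphere s₀ ψ : H) - toSphere s₀ φ‖) := by ring
      _ ≤ η * (Real.pi / 2) * (2 * ‖ψ - φ‖) := hdist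
      _ = (NNReal.pi * η : ℝ≥0) * ‖ψ - φ‖ := by
          rw [NNReal.coe_mul, NNReal.coe_real_pi]
          ring

end Sphere

section Gap

variable {H : Type*} [NormedAddCommGroup H] [InnerProductSpace ℂ H] [CompleteSpace H]

theorem DensityOperator.nonempty_sphere (ρ : DensityOperator H) :
    Nonempty (Metric.sphere (0 : H) 1) := by
  by_contra h
  have hempty : IsEmpty ρ.eigenONB.index :=
    ⟨fun n => h ⟨⟨ρ.eigenONB.basis n, by simp [ρ.eigenONB.basis.orthonormal.1]⟩⟩⟩
  simpa using ρ.tsum_eigenvalue ρ.eigenONB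

variable [TopologicalSpace.SeparableSpace H] [MeasurableSpace H] [BorelSpace H]
  (ρ : DensityOperator H)

instance isProbabilityMeasure_adjustedMeasure_gaussianMeasure :
    IsProbabilityMeasure (adjustedMeasure (gaussianMeasure ρ)) :=
  ⟨by rw [adjustedMeasure, withDensity_apply _ MeasurableSet.univ, setLIntegral_univ,
    lintegral_norm_sq_gaussianMeasure]⟩

theorem gapMeasure_eq_map_toSphere (s₀ : Metric.sphere (0 : H) 1) :
    gapMeasure ρ = (adjustedMeasure (gaussianMeasure ρ)).map (toSphere s₀) := by
  have : SecondCountableTopology H := UniformSpace.secondCountable_of_separable H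
  have hemb := MeasurableEmbedding.subtype_coe
    (Metric.isClosed_sphere (x := (0 : H)) (ε := 1)).measurableSet
  have hmap : (gaMeasure ρ).map (fun ψ => ((‖ψ‖⁻¹ : ℝ) : ℂ) • ψ) =
      ((adjustedMeasure (gaussianMeasure ρ)).map (toSphere s₀)).map (↑) := by
    rw [Measure.map_map hemb.measurable (measurable_toSphere s₀)]
    refine Measure.map_congr ?_
    filter_upwards [ae_ne_zero_adjustedMeasure (μ := gaussianMeasure ρ)] with ψ hψ
    exact (coe_toSphere s₀ hψ).symm
  rw [gapMeasure, hmap, hemb.comap_map]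

theorem AngularLipschitz.adjustedMeasure_gaussianMeasure_lt_abs_sub_integral_le {B : ℝ≥0}
    {q : H → ℝ} (hq : AngularLipschitz B q) {ε : ℝ} (hε : 0 ≤ ε) :
    adjustedMeasure (gaussianMeasure ρ)
        {ψ | ε < |q ψ - ∫ φ, q φ ∂(adjustedMeasure (gaussianMeasure ρ))|} ≤
      ENNReal.ofReal (6 * Real.exp (-(ε ^ 2 / (18 * Real.pi ^ 2 * B ^ 2 * ‖ρ.op‖)))) := by
  convert hq.adjustedMeasure_lt_abs_sub_integral_le (subgaussianLipschitz_gaussianMeasure ρ) hε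
    using 6
  push_cast [NNReal.coe_real_pi]
  ring

end Gap

theorem theorem2 {H : Type*} [NormedAddCommGroup H] [InnerProductSpace ℂ H] [CompleteSpace H]
    [TopologicalSpace.SeparableSpace H] [MeasurableSpace H] [BorelSpace H]
    (ρ : DensityOperator H) (f : Metric.sphere (0 : H) 1 → ℝ) (η : ℝ) (hη : 0 < η)
    (hf : ∀ ψ φ, |f ψ - f φ| ≤ η * sphericalDist ψ φ) (ε : ℝ) (hε : 0 ≤ ε) :
    IsProbabilityMeasure (gapMeasure ρ) ∧
    Integrable f (gapMeasure ρ) ∧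
    gapMeasure ρ {ψ | ε < |f ψ - ∫ φ, f φ ∂(gapMeasure ρ)|} ≤
      ENNReal.ofReal
        (6 * Real.exp (-((1 / (288 * Real.pi ^ 2)) * ε ^ 2 / (η ^ 2 * ‖ρ.op‖)))) := by
  have : SecondCountableTopology H := UniformSpace.secondCountable_of_separable H
  lift η to ℝ≥0 using hη.le
  obtain ⟨s₀⟩ := ρ.nonempty_sphere
  have hfm : Measurable f := (continuous_of_abs_sub_le_sphericalDist hf).measurable
  have hproj : Measurable (toSphere s₀) := measurable_toSphere s₀
  have hang := angularLipschitz_comp_toSphere s₀ hf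
  rw [gapMeasure_eq_map_toSphere ρ s₀]
  refine ⟨Measure.isProbabilityMeasure_map hproj.aemeasurable,
    (integrable_map_measure hfm.aestronglyMeasurable hproj.aemeasurable).2 (hang.integrable _), ?_⟩
  rw [integral_map hproj.aemeasurable hfm.aestronglyMeasurable,
    Measure.map_apply hproj (measurableSet_lt measurable_const (by fun_prop))]
  refine (hang.adjustedMeasure_gaussianMeasure_lt_abs_sub_integral_le ρ hε).trans ?_
  gcongr ENNReal.ofReal (6 * Real.exp (-?_))
  calc 1 / (288 * Real.pi ^ 2) * ε ^ 2 / (η ^ 2 * ‖ρ.op‖)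
      = 1 / (18 * Real.pi ^ 2 * 4 ^ 2) * (ε ^ 2 / (η ^ 2 * ‖ρ.op‖)) := by ring
    _ ≤ 1 / (18 * Real.pi ^ 2 * Real.pi ^ 2) * (ε ^ 2 / (η ^ 2 * ‖ρ.op‖)) := by
        gcongr
        exact Real.pi_le_four
    _ = ε ^ 2 / (18 * Real.pi ^ 2 * (NNReal.pi * η : ℝ≥0) ^ 2 * ‖ρ.op‖) := by
        rw [NNReal.coe_mul, NNReal.coe_real_pi]
        ring
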